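/- Let $n \ge 3$ and let $\Delta^n = \{x \in \mathbb{R}^{n+1} : x_j \ge 0,\ \sum_{j=1}^{n+1} x_j = 1\}$ be the regular $n$-simplex, with boundary $\partial\Delta^n$ taken relative to its affine hull. For a unit vector $a \in S^n \subset \mathbb{R}^{n+1}$ with $\sum_{j=1}^{n+1} a_j = 0$ and $t \in \mathbb{R}$, let $$P(a,t) = \mathrm{vol}_{n-2}\big(\{x \in \partial\Delta^n : \langle a, x\rangle = t\}\big)$$ be the perimeter of the corresponding hyperplane section, and let $a^{[2]} = \frac{1}{\sqrt 2}(1,-1,0,\ldots,0) \in S^n$. Then, for every $a \in S^n$ with $\sum_{j=1}^{n+1} a_j = 0$, $$P(a,0) \le \frac{\sqrt n}{(n-2)!}\,\frac{n+1}{\sqrt 2} \le \Big(1 + \frac 1 n\Big)\, P(a^{[2]},0).$$ -/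

import Mathlib

open MeasureTheory
open scoped ENNReal Nat

noncomputable section

/-- The regular `n`-simplex `Δⁿ`: the standard simplex in Euclidean space `ℝⁿ⁺¹`. -/
def regularSimplex (n : ℕ) : Set (EuclideanSpace ℝ (Fin (n + 1))) :=
  {x | (∀ j, 0 ≤ x j) ∧ ∑ j, x j = 1}

/-- The hyperplane `H_t(a) = {x | ⟨a, x⟩ = t}`. -/
def sectionHyperplane {n : ℕ} (a : EuclideanSpace ℝ (Fin (n + 1))) (t : ℝ) :
    Set (EuclideanSpace ℝ (Fin (n + 1))) :=
  {x | inner ℝ a x = t}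

/-- The perimeter function `P(a, t)` of the regular `n`-simplex: the `(n-2)`-dimensional volume
(Hausdorff measure, normalized to agree with Lebesgue measure on `ℝⁿ⁻²`) of the intersection of
`H_t(a)` with the boundary of `Δⁿ`. Since `Δⁿ` is `n`-dimensional in `ℝⁿ⁺¹`, its boundary is the
one relative to its affine hull. Meaningful for `n ≥ 2`. -/
def simplexPerimeter (n : ℕ) (a : EuclideanSpace ℝ (Fin (n + 1))) (t : ℝ) : ℝ≥0∞ :=
  μHE[n - 2] (sectionHyperplane a t ∩ intrinsicFrontier ℝ (regularSimplex n))

/-- The vector `a^{[2]} = (1/√2) (1, -1, 0, …, 0)` in `ℝⁿ⁺¹` (for `n ≥ 1`). -/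
def edgeDirection (n : ℕ) : EuclideanSpace ℝ (Fin (n + 1)) :=
  WithLp.toLp 2 fun j =>
    if j.val = 0 then 1 / Real.sqrt 2 else if j.val = 1 then -(1 / Real.sqrt 2) else 0

end

/-! The upper bound is a volume bound followed by a comparison of perimeter with volume.

Volume: let `X_j` be independent standard exponentials and `Y = ∑ a_j X_j`, so `Y` has mean 0 and
variance 1. Slicing the exponential law by the level sets of `∑ x_j` shows that the density of `Y`
at 0 is at least `n!` times the volume of the solid simplex cut by `a^⊥`. This density is at most
`1/√2`. Indeed both tails of `Y` are log-concave. Write `p = P(Y > 0)`, `q = P(Y ≤ 0)`, `m = E Y⁺ =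
E Y⁻` and `f` for the density at 0. Log-concavity gives `f m ≤ p²` and `f m ≤ q²`, and also `p
E(Y⁺)² / 2 ≤ m²` and `q E(Y⁻)² / 2 ≤ m²`, whence `p q ≤ 2 m²`. So `f² ≤ (p q / m)² ≤ 2 p q ≤ 1/2`.
The proof runs this with `P(0 < Y ≤ ε)` in place of `f` (`sq_measure_Ioc_le_of_isFourPoint`) and
lets `ε → 0`, which makes densities unnecessary. Since the cut solid simplex contains a cone over
the central section, `euclideanHausdorffMeasure_centralSection_le` follows.

Perimeter: the central section contains the centroid of the simplex. Cones from the centroid over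
its facets do not overlap, and each has height at least the inradius of the simplex, so the
perimeter is at most a constant times the volume
(`euclideanHausdorffMeasure_iUnion_centralFacet_le`).

For `a^{[2]}` the facets of the section are explicit, and bounding their areas from below
(`ofReal_le_euclideanHausdorffMeasure_edgeDirection`) reduces the second inequality to `√n ≤ √2
√(n-1)`. -/

open ProbabilityTheory Set Module

/-! ### Log-concavity and its stability under exponential smoothing. -/

/-- Four-point form of log-concavity for functions with values in `[0, ∞]`. -/
def IsFourPoint (g : ℝ → ℝ≥0∞) : Prop :=
  ∀ y x s : ℝ, 0 ≤ x → 0 ≤ s → g y * g (y + x + s) ≤ g (y + x) * g (y + s)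

namespace IsFourPoint

variable {g h : ℝ → ℝ≥0∞}

theorem comp_mul (hg : IsFourPoint g) (c : ℝ) : IsFourPoint fun t => g (c * t) := by
  intro y x s hx hs
  rcases le_total 0 c with hc | hc
  · have := hg (c * y) (c * x) (c * s) (by positivity) (by positivity)
    simpa [mul_add] using this
  · have := hg (c * (y + x + s)) (-c * x) (-c * s) (mul_nonneg (by linarith) hx)
      (mul_nonneg (by linarith) hs)
    have e1 : c * (y + x + s) + -c * x = c * (y + s) := by ring
    have e2 : c * (y + x + s) + -c * s = c * (y + x) := by ring
    have e3 : c * (y + x + s) + -c * x + -c * s = c * y := by ring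
    rw [e3, e1, e2] at this
    rw [mul_comm, mul_comm (g (c * (y + x)))]
    exact this

theorem comp_add (hg : IsFourPoint g) (c : ℝ) : IsFourPoint fun t => g (c + t) := by
  intro y x s hx hs
  simpa [add_assoc] using hg (c + y) x s hx hs

theorem mul (hg : IsFourPoint g) (hh : IsFourPoint h) : IsFourPoint fun t => g t * h t := by
  intro y x s hx hs
  calc g y * h y * (g (y + x + s) * h (y + x + s))
      = (g y * g (y + x + s)) * (h y * h (y + x + s)) := by ring
    _ ≤ (g (y + x) * g (y + s)) * (h (y + x) * h (y + s)) :=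
      mul_le_mul' (hg y x s hx hs) (hh y x s hx hs)
    _ = _ := by ring

theorem exp (c : ℝ) : IsFourPoint fun t => ENNReal.ofReal (Real.exp (c * t)) := by
  intro y x s _ _
  rw [← ENNReal.ofReal_mul (by positivity), ← ENNReal.ofReal_mul (by positivity),
    ← Real.exp_add, ← Real.exp_add]
  apply le_of_eq
  congr 2
  ring

theorem indicator_Iio : IsFourPoint (indicator (Iio 0) 1) := by
  intro y x s hx hs
  by_cases h : y + x + s < 0
  · have h1 : y < 0 := by linarith
    have h2 : y + x < 0 := by linarith
    have h3 : y + s < 0 := by linarith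
    simp [indicator, h, h1, h2, h3]
  · simp [indicator, h]

theorem indicator_Ici : IsFourPoint (indicator (Ici 0) 1) := by
  intro y x s hx hs
  by_cases h : 0 ≤ y
  · have h1 : 0 ≤ y + x := by linarith
    have h2 : 0 ≤ y + s := by linarith
    have h3 : 0 ≤ y + x + s := by linarith
    simp [indicator, h, h1, h2, h3]
  · simp [indicator, h]

theorem setLIntegral_Ici_add (g : ℝ → ℝ≥0∞) (t s : ℝ) :
    ∫⁻ u in Ici (t + s), g u = ∫⁻ u in Ici t, g (u + s) := by
  have := (measurePreserving_add_right (volume : Measure ℝ) s).setLIntegral_comp_preimage_emb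
    (MeasurableEquiv.addRight s).measurableEmbedding g (Ici (t + s))
  rw [← this]
  simp

theorem setLIntegral_Ioi_add (g : ℝ → ℝ≥0∞) (t s : ℝ) :
    ∫⁻ u in Ioi (t + s), g u = ∫⁻ u in Ioi t, g (u + s) := by
  have := (measurePreserving_add_right (volume : Measure ℝ) s).setLIntegral_comp_preimage_emb
    (MeasurableEquiv.addRight s).measurableEmbedding g (Ioi (t + s))
  rw [← this]
  simp

/-- The tail integral of a log-concave function is log-concave. -/
theorem tail (hm : Measurable g) (hg : IsFourPoint g) :
    IsFourPoint fun t => ∫⁻ u in Ici t, g u := by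
  intro y x s hx hs
  have split : ∀ f : ℝ → ℝ≥0∞,
      ∫⁻ u in Ici y, f u = (∫⁻ u in Ico y (y + x), f u) + ∫⁻ u in Ici (y + x), f u := by
    intro f
    rw [← lintegral_union measurableSet_Ici, Ico_union_Ici_eq_Ici (by linarith)]
    rw [disjoint_left]
    intro u hu hu'
    exact absurd hu.2 (not_lt.2 hu')
  have hms : Measurable fun u => g (u + s) := hm.comp (measurable_id.add_const s)
  -- Once `[y, ∞)` is split at `y + x`, both sides share the term with both integrals over `[y + x,
  -- ∞)`. In the rest `u < y + x ≤ v`, and the four-point inequality for `u, v, u + s, v + s` holds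
  -- pointwise.
  have key : (∫⁻ u in Ico y (y + x), g u) * (∫⁻ v in Ici (y + x), g (v + s)) ≤
      (∫⁻ u in Ico y (y + x), g (u + s)) * ∫⁻ v in Ici (y + x), g v := by
    rw [← lintegral_lintegral_mul hm.aemeasurable hms.aemeasurable,
      ← lintegral_lintegral_mul hms.aemeasurable hm.aemeasurable]
    refine setLIntegral_mono' measurableSet_Ico fun u hu => ?_
    refine setLIntegral_mono' measurableSet_Ici fun v hv => ?_
    have := hg u (v - u) s (by linarith [hu.2, mem_Ici.1 hv]) hs
    rw [show u + (v - u) = v by ring] at this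
    rw [mul_comm (g (u + s))]
    exact this
  change (∫⁻ u in Ici y, g u) * (∫⁻ u in Ici (y + x + s), g u) ≤
    (∫⁻ u in Ici (y + x), g u) * ∫⁻ u in Ici (y + s), g u
  rw [setLIntegral_Ici_add, setLIntegral_Ici_add g y s, split g, split fun u => g (u + s)]
  rw [add_mul, mul_add]
  gcongr ?_ + _
  rw [mul_comm (∫⁻ v in Ici (y + x), g v)]
  exact key

theorem lintegral_expMeasure {f : ℝ → ℝ≥0∞} (hf : Measurable f) :
    ∫⁻ x, f x ∂(expMeasure 1) = ∫⁻ x in Ici 0, f x * ENNReal.ofReal (Real.exp (-x)) := by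
  rw [expMeasure, gammaMeasure, lintegral_withDensity_eq_lintegral_mul _ (by
    exact (measurable_gammaPDFReal 1 1).ennreal_ofReal) hf, ← lintegral_indicator measurableSet_Ici]
  refine lintegral_congr fun x => ?_
  have := exponentialPDF_eq 1 x
  rw [exponentialPDF, exponentialPDFReal] at this
  rw [Pi.mul_apply, gammaPDF, this]
  by_cases hx : 0 ≤ x <;> simp [indicator, hx, mul_comm]

/-- The substitution `u = x - t / a` turns the smoothed function into `exp (-t / a)` times the tail
from `-t / a` of `u ↦ g (-a u) exp (-u)`. Hence `tail` replaces the Prékopa–Leindler inequality, for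
either sign of `a`. -/
theorem lintegral_expMeasure_comp (hm : Measurable g) (hg : IsFourPoint g) (a : ℝ) :
    IsFourPoint fun t => ∫⁻ x, g (t - a * x) ∂(expMeasure 1) := by
  have : IsProbabilityMeasure (expMeasure 1) := isProbabilityMeasure_expMeasure one_pos
  rcases eq_or_ne a 0 with rfl | ha
  · simpa using hg
  have hh : IsFourPoint fun x => g (-a * x) * ENNReal.ofReal (Real.exp (-1 * x)) :=
    (hg.comp_mul (-a)).mul (exp (-1))
  have hhm : Measurable fun x => g (-a * x) * ENNReal.ofReal (Real.exp (-1 * x)) := by fun_prop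
  have h3 := ((hh.tail hhm).comp_mul (-a⁻¹)).mul (exp (-a⁻¹))
  convert h3 using 2 with t
  rw [lintegral_expMeasure (by fun_prop), ← zero_add (-a⁻¹ * t), setLIntegral_Ici_add,
    ← lintegral_mul_const _ (by fun_prop)]
  refine lintegral_congr fun x => ?_
  rw [mul_assoc, ← ENNReal.ofReal_mul (by positivity), ← Real.exp_add]
  congr 2
  · field_simp
    ring
  · congr 1
    ring

end IsFourPoint

/-- The coordinates are integrated out one at a time. Taking `g` to be the indicator of `Iio 0` or
`Ici 0` gives the right tail or the distribution function of `∑ a_j X_j`. -/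
theorem isFourPoint_lintegral_pi_expMeasure {n : ℕ} (a : Fin n → ℝ) {g : ℝ → ℝ≥0∞}
    (hm : Measurable g) (hg : IsFourPoint g) :
    IsFourPoint fun t => ∫⁻ x, g (t - ∑ j, a j * x j) ∂(Measure.pi fun _ => expMeasure 1) := by
  have : IsProbabilityMeasure (expMeasure 1) := isProbabilityMeasure_expMeasure one_pos
  induction n generalizing g with
  | zero => simpa using hg
  | succ n ih =>
    have h1 := ih (fun j => a j.succ) (g := fun t => ∫⁻ x, g (t - a 0 * x) ∂(expMeasure 1))
      (by
        have : Measurable (Function.uncurry fun t x : ℝ => g (t - a 0 * x)) := by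
          unfold Function.uncurry; fun_prop
        exact this.lintegral_prod_right) (hg.lintegral_expMeasure_comp hm (a 0))
    convert h1 using 2 with t
    have mp := (measurePreserving_piFinSuccAbove (fun _ : Fin (n + 1) => expMeasure 1) 0)
    rw [← mp.symm.lintegral_comp_emb (MeasurableEquiv.measurableEmbedding _),
      lintegral_prod_symm _ (by
        refine Measurable.aemeasurable ?_
        fun_prop)]
    refine lintegral_congr fun x => lintegral_congr fun y => ?_
    congr 1
    rw [Fin.sum_univ_succ]
    simp [MeasurableEquiv.piFinSuccAbove]
    ring

/-! ### Integral inequalities for log-concave functions on the half-line. -/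

namespace IsFourPoint

variable {F : ℝ → ℝ≥0∞}

/-- In the positive quadrant, the points with `s + x = z` are parametrized by `0 < x < z`, an
interval of length `z`. -/
theorem lintegral_lintegral_Ioi_add (hm : Measurable F) :
    ∫⁻ x in Ioi (0 : ℝ), ∫⁻ s in Ioi (0 : ℝ), F (s + x) =
      ∫⁻ z in Ioi (0 : ℝ), F z * ENNReal.ofReal z := by
  have h1 : ∀ x ∈ Ioi (0 : ℝ), ∫⁻ s in Ioi (0 : ℝ), F (s + x) =
      ∫⁻ z in Ioi (0 : ℝ), (Iio z).indicator (fun _ => F z) x := by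
    intro x hx
    rw [← setLIntegral_Ioi_add F 0 x, zero_add, ← lintegral_indicator measurableSet_Ioi,
      ← lintegral_indicator measurableSet_Ioi]
    refine lintegral_congr fun z => ?_
    have hx : 0 < x := hx
    by_cases h : x < z
    · simp [indicator, h, hx.trans h]
    · simp [indicator, h]
  rw [setLIntegral_congr_fun measurableSet_Ioi h1, lintegral_lintegral_swap]
  · refine setLIntegral_congr_fun measurableSet_Ioi fun z hz => ?_
    rw [lintegral_indicator measurableSet_Iio, Measure.restrict_restrict measurableSet_Iio]
    rw [inter_comm, Ioi_inter_Iio]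
    simp
  · have : Function.uncurry (fun x z : ℝ => (Iio z).indicator (fun _ => F z) x) =
      indicator {p : ℝ × ℝ | p.1 < p.2} fun p => F p.2 := by
      ext p
      simp [indicator, Function.uncurry]
    rw [this]
    exact ((hm.comp measurable_snd).indicator
      (measurableSet_lt measurable_fst measurable_snd)).aemeasurable

/-- Integrate `F 0 * F (x + s) ≤ F x * F s` over the positive quadrant. -/
theorem mul_lintegral_mul_le (hm : Measurable F) (hF : IsFourPoint F) :
    F 0 * ∫⁻ z in Ioi (0 : ℝ), F z * ENNReal.ofReal z ≤ (∫⁻ z in Ioi (0 : ℝ), F z) ^ 2 := by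
  rw [← lintegral_lintegral_Ioi_add hm, sq, ← lintegral_lintegral_mul hm.aemeasurable
    hm.aemeasurable, ← lintegral_const_mul _ (by
      have : Measurable (Function.uncurry fun x s : ℝ => F (s + x)) := by
        unfold Function.uncurry; fun_prop
      exact this.lintegral_prod_right)]
  refine setLIntegral_mono' measurableSet_Ioi fun x hx => ?_
  rw [← lintegral_const_mul _ (by fun_prop)]
  refine setLIntegral_mono' measurableSet_Ioi fun s hs => ?_
  have := hF 0 x s (le_of_lt hx) (le_of_lt hs)
  rw [zero_add, zero_add, add_comm x s] at this
  exact this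

theorem lintegral_Ioi_le_add (hanti : Antitone F) {ε : ℝ} (hε : 0 ≤ ε) :
    ∫⁻ x in Ioi (0 : ℝ), F x ≤ ENNReal.ofReal ε * F 0 + ∫⁻ x in Ioi (0 : ℝ), F (x + ε) := by
  rw [← setLIntegral_Ioi_add F 0 ε, zero_add, ← Ioc_union_Ioi_eq_Ioi hε,
    lintegral_union measurableSet_Ioi (by
    rw [disjoint_left]
    intro u hu hu'
    exact absurd hu.2 (not_le.2 hu'))]
  gcongr ?_ + _
  calc ∫⁻ x in Ioc 0 ε, F x ≤ ∫⁻ _ in Ioc 0 ε, F 0 :=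
        setLIntegral_mono' measurableSet_Ioc fun x hx => hanti hx.1.le
    _ = _ := by simp [mul_comm]

/-- A finite-difference version of `-F'(0) ∫ F ≤ F(0)²`, obtained by integrating `F 0 * F (x + ε) ≤
F ε * F x` over `x`. -/
theorem mul_lintegral_add_le (hm : Measurable F) (hF : IsFourPoint F) (hanti : Antitone F)
    {ε : ℝ} (hε : 0 ≤ ε) :
    F 0 * ∫⁻ x in Ioi (0 : ℝ), F (x + ε) ≤
      F ε * (ENNReal.ofReal ε * F 0 + ∫⁻ x in Ioi (0 : ℝ), F (x + ε)) := by
  have h1 : F 0 * ∫⁻ x in Ioi (0 : ℝ), F (x + ε) ≤ F ε * ∫⁻ x in Ioi (0 : ℝ), F x := by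
    rw [← lintegral_const_mul _ (by fun_prop), ← lintegral_const_mul _ (by fun_prop)]
    refine setLIntegral_mono' measurableSet_Ioi fun x hx => ?_
    have := hF 0 x ε (le_of_lt hx) hε
    rw [zero_add, zero_add, mul_comm (F x)] at this
    exact this
  refine h1.trans ?_
  gcongr F ε * ?_
  exact lintegral_Ioi_le_add hanti hε

end IsFourPoint

/-! ### First and second half-moments as tail integrals, and the small-ball bound. -/

theorem lintegral_ofReal_sq_half_pos (μ : Measure ℝ) :
    ∫⁻ y, ENNReal.ofReal ((max y 0) ^ 2 / 2) ∂μ =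
      ∫⁻ t in Ioi (0 : ℝ), μ (Ioi t) * ENNReal.ofReal t := by
  have := lintegral_comp_eq_lintegral_meas_lt_mul (g := fun t => t) μ (f := fun y : ℝ => max y 0)
    (Filter.Eventually.of_forall fun y => le_max_right _ _) (by fun_prop)
    (fun t _ => continuous_id.intervalIntegrable _ _)
    ((ae_restrict_mem measurableSet_Ioi).mono fun t ht => le_of_lt ht)
  simp only [integral_id] at this
  simp only [ne_eq, OfNat.ofNat_ne_zero, not_false_eq_true, zero_pow, sub_zero] at this
  rw [this]
  refine setLIntegral_congr_fun measurableSet_Ioi fun t ht => ?_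
  have ht : 0 < t := ht
  congr 2
  ext y
  simp [ht.not_gt]

theorem lintegral_ofReal_sq_half_neg (μ : Measure ℝ) :
    ∫⁻ y, ENNReal.ofReal ((max (-y) 0) ^ 2 / 2) ∂μ =
      ∫⁻ t in Ioi (0 : ℝ), μ (Iic (-t)) * ENNReal.ofReal t := by
  have := lintegral_comp_eq_lintegral_meas_le_mul (g := fun t => t) μ
    (f := fun y : ℝ => max (-y) 0)
    (Filter.Eventually.of_forall fun y => le_max_right _ _) (by fun_prop)
    (fun t _ => continuous_id.intervalIntegrable _ _)
    ((ae_restrict_mem measurableSet_Ioi).mono fun t ht => le_of_lt ht)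
  simp only [integral_id] at this
  simp only [ne_eq, OfNat.ofNat_ne_zero, not_false_eq_true, zero_pow, sub_zero] at this
  rw [this]
  refine setLIntegral_congr_fun measurableSet_Ioi fun t ht => ?_
  have ht : 0 < t := ht
  congr 2
  ext y
  simp [ht.not_ge, le_neg]

theorem lintegral_ofReal_pos (μ : Measure ℝ) :
    ∫⁻ y, ENNReal.ofReal y ∂μ = ∫⁻ t in Ioi (0 : ℝ), μ (Ioi t) := by
  have := lintegral_eq_lintegral_meas_lt μ (f := fun y : ℝ => max y 0)
    (Filter.Eventually.of_forall fun y => le_max_right _ _) (by fun_prop)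
  simp only [ENNReal.ofReal_max, ENNReal.ofReal_zero, zero_le, max_eq_left] at this
  rw [this]
  refine setLIntegral_congr_fun measurableSet_Ioi fun t ht => ?_
  have ht : 0 < t := ht
  congr 1
  ext y
  simp [ht.not_gt]

theorem lintegral_ofReal_neg (μ : Measure ℝ) :
    ∫⁻ y, ENNReal.ofReal (-y) ∂μ = ∫⁻ t in Ioi (0 : ℝ), μ (Iic (-t)) := by
  have := lintegral_eq_lintegral_meas_le μ (f := fun y : ℝ => max (-y) 0)
    (Filter.Eventually.of_forall fun y => le_max_right _ _) (by fun_prop)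
  simp only [ENNReal.ofReal_max, ENNReal.ofReal_zero, zero_le, max_eq_left] at this
  rw [this]
  refine setLIntegral_congr_fun measurableSet_Ioi fun t ht => ?_
  have ht : 0 < t := ht
  congr 1
  ext y
  simp [ht.not_ge, le_neg]

/-- The arithmetic of the density bound. Here `p, q` are the masses of the two half-lines, `D` and
`τ` those of `(0, ε]` and `(ε, ∞)`, `m` the common half-mean, `j, k` half the second half-moments,
and `N` the integral of the right tail from `ε` on. -/
theorem sq_le_of_tail_bounds {ε p q D τ m N j k : ℝ} (hε : 0 < ε) (hp : 0 ≤ p) (hq : 0 < q)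
    (hD : 0 ≤ D) (hτ : 0 ≤ τ) (hpq : p + q = 1) (hpD : p = D + τ) (hjk : j + k = 1 / 2)
    (r1 : p * j ≤ m ^ 2) (r2 : q * k ≤ m ^ 2) (r3 : p * N ≤ τ * (ε * p + N))
    (hm : 0 ≤ m) (r4 : m ≤ ε * p + N) (r5 : (q + D) * m ≤ q * (ε * (q + D) + m)) :
    D ^ 2 ≤ ε ^ 2 / 2 + 4 * ε ^ 3 := by
  have k1 : D * m ≤ ε * p ^ 2 := by
    have h1 : D * N ≤ τ * (ε * p) := by
      have : D * N = p * N - τ * N := by rw [hpD]; ring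
      linarith
    have h2 : ε * p ^ 2 = D * (ε * p) + τ * (ε * p) := by rw [hpD]; ring
    have h3 := mul_le_mul_of_nonneg_left r4 hD
    linarith
  have k2 : D * m ≤ ε * (q * (q + D)) := by linarith
  have k3 : p * q ≤ 2 * m ^ 2 := by
    have a1 := mul_le_mul_of_nonneg_left r1 hq.le
    have a2 := mul_le_mul_of_nonneg_left r2 hp
    have a3 : p * q * (j + k) ≤ m ^ 2 * (p + q) := by linarith
    rw [hjk, hpq] at a3
    linarith
  have hDp : D ≤ p := by linarith
  -- Multiply `k1` by `k2`, replace `m ^ 2` by its lower bound `p q / 2`, and cancel `p q`.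
  have k4 : D ^ 2 ≤ 2 * ε ^ 2 * (p * (q + D)) := by
    rcases hp.eq_or_lt with h | hp'
    · have : D = 0 := by linarith
      rw [this, ← h]
      simp
    · have h1 : D ^ 2 * (p * q) ≤ 2 * ε ^ 2 * (p * (q + D)) * (p * q) := by
        calc D ^ 2 * (p * q) ≤ D ^ 2 * (2 * m ^ 2) := by gcongr
          _ = 2 * ((D * m) * (D * m)) := by ring
          _ ≤ 2 * ((ε * p ^ 2) * (ε * (q * (q + D)))) := by gcongr
          _ = _ := by ring
      exact le_of_mul_le_mul_right h1 (by positivity)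
  have hpq4 : p * q ≤ 1 / 4 := by
    have : q = 1 - p := by linarith
    rw [this]
    linarith [sq_nonneg (p - 1 / 2)]
  have hpD' : p * D ≤ D := mul_le_of_le_one_left hD (by linarith)
  -- A crude bound on `D` from `k4`, fed back into `k4` to bound the factor `q + D`.
  have k5 : D ≤ 2 * ε := by
    refine (pow_le_pow_iff_left₀ hD (by positivity) two_ne_zero).1 ?_
    have : p * (q + D) ≤ 2 := by linarith
    linarith [mul_le_mul_of_nonneg_left this (sq_nonneg ε)]
  have k6 : p * (q + D) ≤ 1 / 4 + 2 * ε := by linarith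
  linarith [mul_le_mul_of_nonneg_left k6 (sq_nonneg ε)]

/-- If the two tails of a centred probability measure of variance one are log-concave, then its
density at the origin is at most `1 / √2`, in a quantitative form. -/
theorem sq_measure_Ioc_le_of_isFourPoint (μ : Measure ℝ) [IsProbabilityMeasure μ]
    (hT : IsFourPoint fun t => μ (Ioi t)) (hR : IsFourPoint fun t => μ (Iic t))
    (hint : Integrable (fun y => y) μ) (hmean : ∫ y, y ∂μ = 0)
    (hint2 : Integrable (fun y => y ^ 2) μ) (hvar : ∫ y, y ^ 2 ∂μ = 1) {ε : ℝ} (hε : 0 < ε) :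
    μ.real (Ioc 0 ε) ^ 2 ≤ ε ^ 2 / 2 + 4 * ε ^ 3 := by
  have antiT : Antitone fun t => μ (Ioi t) := fun s t hst => measure_mono (Ioi_subset_Ioi hst)
  have monoR : Monotone fun t => μ (Iic t) := fun s t hst => measure_mono (Iic_subset_Iic.2 hst)
  have mT := antiT.measurable
  have mR := monoR.measurable
  set Mp := ∫⁻ t in Ioi (0 : ℝ), μ (Ioi t) with hMp
  set Mm := ∫⁻ t in Ioi (0 : ℝ), μ (Iic (-t)) with hMm
  set Jp := ∫⁻ t in Ioi (0 : ℝ), μ (Ioi t) * ENNReal.ofReal t with hJp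
  set Jm := ∫⁻ t in Ioi (0 : ℝ), μ (Iic (-t)) * ENNReal.ofReal t with hJm
  have hMp_ne : Mp ≠ ∞ := by
    rw [hMp, ← lintegral_ofReal_pos]
    exact hint.lintegral_lt_top.ne
  have hMm_ne : Mm ≠ ∞ := by
    rw [hMm, ← lintegral_ofReal_neg]
    exact hint.neg.lintegral_lt_top.ne
  have hMeq : Mp.toReal = Mm.toReal := by
    rw [integral_eq_lintegral_pos_part_sub_lintegral_neg_part hint, lintegral_ofReal_pos,
      lintegral_ofReal_neg] at hmean
    linarith
  have hJsum : Jp + Jm = ENNReal.ofReal (1 / 2) := by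
    rw [hJp, hJm, ← lintegral_ofReal_sq_half_pos, ← lintegral_ofReal_sq_half_neg,
      ← lintegral_add_left (by fun_prop), ← hvar, ← integral_div,
      ofReal_integral_eq_lintegral_ofReal (hint2.div_const 2)
        (Filter.Eventually.of_forall fun y => by positivity)]
    refine lintegral_congr fun y => ?_
    rw [← ENNReal.ofReal_add (by positivity) (by positivity)]
    congr 1
    rcases le_total 0 y with h | h
    · rw [max_eq_left h, max_eq_right (by linarith)]
      ring
    · rw [max_eq_right h, max_eq_left (by linarith)]
      ring
  have hJp_ne : Jp ≠ ∞ := ne_top_of_le_ne_top ENNReal.ofReal_ne_top (hJsum ▸ le_self_add)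
  have hJm_ne : Jm ≠ ∞ := ne_top_of_le_ne_top ENNReal.ofReal_ne_top (hJsum ▸ le_add_self)
  have hJsum' : Jp.toReal + Jm.toReal = 1 / 2 := by
    rw [← ENNReal.toReal_add hJp_ne hJm_ne, hJsum, ENNReal.toReal_ofReal (by norm_num)]
  have hRn : IsFourPoint fun t => μ (Iic (-t)) := by
    simpa using hR.comp_mul (-1)
  have hpJ := hT.mul_lintegral_mul_le mT
  have hqJ := hRn.mul_lintegral_mul_le (F := fun t => μ (Iic (-t)))
    (mR.comp measurable_neg)
  have hpq : μ.real (Ioi 0) + μ.real (Iic 0) = 1 := by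
    have := probReal_compl_eq_one_sub (μ := μ) (measurableSet_Iic (a := (0 : ℝ)))
    rw [compl_Iic] at this
    linarith
  have hTε : μ.real (Ioi 0) = μ.real (Ioc 0 ε) + μ.real (Ioi ε) := by
    rw [← measureReal_union (by
      rw [disjoint_left]
      intro u hu hu'
      exact absurd hu.2 (not_le.2 hu')) measurableSet_Ioi, Ioc_union_Ioi_eq_Ioi hε.le]
  have hRε : μ.real (Iic ε) = μ.real (Iic 0) + μ.real (Ioc 0 ε) := by
    rw [← measureReal_union (by
      rw [disjoint_left]
      intro u hu hu'
      exact absurd hu'.1 (not_lt.2 hu)) measurableSet_Ioc, Iic_union_Ioc_eq_Iic hε.le]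
  have hD1 := hT.mul_lintegral_add_le mT antiT hε.le
  have hN := IsFourPoint.lintegral_Ioi_le_add antiT hε.le
  -- The left tail is started at `ε` rather than 0, so that both tail estimates involve the mass of
  -- the same interval `(0, ε]`.
  have hRe : IsFourPoint fun t => μ (Iic (ε - t)) := by
    have := hRn.comp_add (-ε)
    simpa [sub_eq_add_neg, add_comm] using this
  have hD2 := hRe.mul_lintegral_add_le (F := fun t => μ (Iic (ε - t)))
    (mR.comp (measurable_const.sub measurable_id)) (fun s t hst => monoR (by linarith)) hε.le
  simp only [sub_zero, sub_self] at hD2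
  have e1 : ∀ x : ℝ, ε - (x + ε) = -x := fun x => by ring
  simp only [e1] at hD2
  rw [← hMm] at hD2
  rw [← hMp] at hN
  simp only [neg_zero] at hqJ
  rw [← hJm, ← hMm] at hqJ
  rw [← hJp, ← hMp] at hpJ
  set N := ∫⁻ x in Ioi (0 : ℝ), μ (Ioi (x + ε)) with hNdef
  have hNle : N ≤ Mp := setLIntegral_mono' measurableSet_Ioi fun x hx => antiT (by linarith)
  have hN_ne : N ≠ ∞ := ne_top_of_le_ne_top hMp_ne hNle
  set p := μ.real (Ioi 0) with hp
  set q := μ.real (Iic 0) with hq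
  set D := μ.real (Ioc 0 ε) with hD
  have hp0 : 0 ≤ p := measureReal_nonneg
  have hq0 : 0 ≤ q := measureReal_nonneg
  have hD0 : 0 ≤ D := measureReal_nonneg
  have hT0 : 0 ≤ μ.real (Ioi ε) := measureReal_nonneg
  have r1 : p * Jp.toReal ≤ Mp.toReal ^ 2 := by
    have := ENNReal.toReal_mono (by finiteness) hpJ
    rwa [ENNReal.toReal_mul, ENNReal.toReal_pow] at this
  have r2 : q * Jm.toReal ≤ Mm.toReal ^ 2 := by
    have := ENNReal.toReal_mono (by finiteness) hqJ
    rwa [ENNReal.toReal_mul, ENNReal.toReal_pow] at this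
  have r3 : p * N.toReal ≤ μ.real (Ioi ε) * (ε * p + N.toReal) := by
    have := ENNReal.toReal_mono (by finiteness) hD1
    rwa [ENNReal.toReal_mul, ENNReal.toReal_mul, ENNReal.toReal_add (by finiteness) hN_ne,
      ENNReal.toReal_mul, ENNReal.toReal_ofReal hε.le] at this
  have r4 : Mp.toReal ≤ ε * p + N.toReal := by
    have := ENNReal.toReal_mono (by finiteness) hN
    rwa [ENNReal.toReal_add (by finiteness) hN_ne,
      ENNReal.toReal_mul, ENNReal.toReal_ofReal hε.le] at this
  have r5 : μ.real (Iic ε) * Mm.toReal ≤ q * (ε * μ.real (Iic ε) + Mm.toReal) := by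
    have := ENNReal.toReal_mono (by finiteness) hD2
    rwa [ENNReal.toReal_mul, ENNReal.toReal_mul, ENNReal.toReal_add (by finiteness) hMm_ne,
      ENNReal.toReal_mul, ENNReal.toReal_ofReal hε.le] at this
  rw [← hMeq] at r2 r5
  rw [hRε] at r5
  -- If `q = 0`, the left half-moments vanish; then `m = 0`, `p = 1` and `j = 1/2`, contradicting `p
  -- j ≤ m²`.
  have hq' : 0 < q := by
    refine hq0.lt_of_ne fun h => ?_
    have h0 : μ (Iic 0) = 0 := by
      rw [← measureReal_eq_zero_iff]
      exact h.symm
    have hz : ∀ t ∈ Ioi (0 : ℝ), μ (Iic (-t)) = 0 := fun t ht =>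
      measure_mono_null (Iic_subset_Iic.2 (by simpa using le_of_lt ht)) h0
    have hMm0 : Mm = 0 := (setLIntegral_congr_fun measurableSet_Ioi hz).trans lintegral_zero
    have hJm0 : Jm = 0 := (setLIntegral_congr_fun measurableSet_Ioi (g := 0) fun t ht => by
      simp [hz t ht]).trans lintegral_zero
    rw [hMeq, hMm0] at r1
    rw [hJm0] at hJsum'
    simp only [ENNReal.toReal_zero, add_zero] at hJsum' r1
    rw [hJsum'] at r1
    rw [← h] at hpq
    norm_num at r1
    linarith
  exact sq_le_of_tail_bounds hε hp0 hq' hD0 hT0 hpq hTε hJsum' r1 r2 r3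
    ENNReal.toReal_nonneg r4 r5

/-! ### Moments of the exponential law and weighted sums of exponential variables. -/

theorem setLIntegral_Ici_exp_neg_mul_pow (k : ℕ) :
    ∫⁻ x in Ici (0 : ℝ), ENNReal.ofReal (x ^ k) * ENNReal.ofReal (Real.exp (-x)) = (k ! : ℕ) := by
  have h1 := Real.Gamma_eq_integral (s := k + 1) (by positivity)
  have h2 := Real.GammaIntegral_convergent (s := k + 1) (by positivity)
  rw [Real.Gamma_nat_eq_factorial] at h1
  rw [setLIntegral_congr Ioi_ae_eq_Ici.symm, ← ENNReal.ofReal_natCast, h1,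
    ofReal_integral_eq_lintegral_ofReal h2
      ((ae_restrict_mem measurableSet_Ioi).mono fun t (ht : 0 < t) => by simp; positivity)]
  refine setLIntegral_congr_fun measurableSet_Ioi fun t (ht : 0 < t) => ?_
  simp only [add_sub_cancel_right, Real.rpow_natCast]
  rw [← ENNReal.ofReal_mul (by positivity), mul_comm]

theorem ae_nonneg_expMeasure : ∀ᵐ x ∂(expMeasure 1), 0 ≤ x := by
  have h := IsFourPoint.lintegral_expMeasure (f := indicator (Iio 0) 1)
    (measurable_one.indicator measurableSet_Iio)
  rw [lintegral_indicator_one measurableSet_Iio] at h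
  have : ∫⁻ x in Ici (0 : ℝ), indicator (Iio (0 : ℝ)) 1 x * ENNReal.ofReal (Real.exp (-x)) = 0 :=
    (setLIntegral_congr_fun measurableSet_Ici (g := 0) fun t (ht : 0 ≤ t) => by
      simp [indicator, ht.not_gt]).trans lintegral_zero
  rw [this] at h
  rw [ae_iff]
  convert h using 2
  ext x
  simp

theorem lintegral_pow_expMeasure (k : ℕ) :
    ∫⁻ x, ENNReal.ofReal (x ^ k) ∂(expMeasure 1) = (k ! : ℕ) := by
  rw [IsFourPoint.lintegral_expMeasure (by fun_prop), setLIntegral_Ici_exp_neg_mul_pow]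

theorem integrable_pow_expMeasure (k : ℕ) : Integrable (fun x : ℝ => x ^ k) (expMeasure 1) := by
  refine ⟨by fun_prop, ?_⟩
  rw [hasFiniteIntegral_iff_ofReal (ae_nonneg_expMeasure.mono fun x hx => pow_nonneg hx k),
    lintegral_pow_expMeasure]
  exact ENNReal.natCast_lt_top _

theorem integral_pow_expMeasure (k : ℕ) : ∫ x, x ^ k ∂(expMeasure 1) = (k ! : ℕ) := by
  rw [integral_eq_lintegral_of_nonneg_ae (ae_nonneg_expMeasure.mono fun x hx => pow_nonneg hx k)
    (by fun_prop), lintegral_pow_expMeasure, ENNReal.toReal_natCast]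

theorem memLp_id_expMeasure : MemLp (fun x : ℝ => x) 2 (expMeasure 1) :=
  (memLp_two_iff_integrable_sq (by fun_prop)).2 (integrable_pow_expMeasure 2)

theorem integral_id_expMeasure : ∫ x, x ∂(expMeasure 1) = 1 := by
  simpa using integral_pow_expMeasure 1

theorem variance_id_expMeasure : variance (fun x : ℝ => x) (expMeasure 1) = 1 := by
  have : IsProbabilityMeasure (expMeasure 1) := isProbabilityMeasure_expMeasure one_pos
  rw [variance_eq_sub memLp_id_expMeasure, integral_id_expMeasure]
  have := integral_pow_expMeasure 2
  simp only [Pi.pow_apply] at this ⊢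
  rw [this]
  norm_num [Nat.factorial]

/-- The small-ball estimate at the mean for a centred weighted sum of independent standard
exponential variables of variance one. -/
theorem sq_pi_expMeasure_le {n : ℕ} (a : Fin n → ℝ) (hsum : ∑ j, a j = 0)
    (hsq : ∑ j, a j ^ 2 = 1) {ε : ℝ} (hε : 0 < ε) :
    (Measure.pi fun _ : Fin n => expMeasure 1).real {x | 0 < ∑ j, a j * x j ∧ ∑ j, a j * x j ≤ ε} ^ 2
      ≤ ε ^ 2 / 2 + 4 * ε ^ 3 := by
  have : IsProbabilityMeasure (expMeasure 1) := isProbabilityMeasure_expMeasure one_pos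
  set γ : Measure (Fin n → ℝ) := Measure.pi fun _ : Fin n => expMeasure 1 with hγ
  set Y : (Fin n → ℝ) → ℝ := fun x => ∑ j, a j * x j with hY
  have hYm : Measurable Y := by fun_prop
  have : IsProbabilityMeasure (γ.map Y) := Measure.isProbabilityMeasure_map hYm.aemeasurable
  have hX : ∀ j : Fin n, MemLp (fun x : ℝ => a j * x) 2 (expMeasure 1) := fun j =>
    memLp_id_expMeasure.const_mul (a j)
  have hev : ∀ j : Fin n, MemLp (fun x : Fin n → ℝ => a j * x j) 2 γ := fun j =>
    (hX j).comp_measurePreserving (measurePreserving_eval _ j)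
  have hYL : MemLp Y 2 γ := memLp_finsetSum _ fun j _ => hev j
  have hYint : Integrable Y γ := hYL.integrable (by norm_num)
  have hmean : ∫ x, Y x ∂γ = 0 := by
    rw [hY, integral_finsetSum _ fun j _ => (hev j).integrable (by norm_num), ← hsum]
    refine Finset.sum_congr rfl fun j _ => ?_
    rw [integral_const_mul]
    have hj : AEMeasurable (fun x : Fin n → ℝ => x j) γ :=
      (measurable_pi_apply j).aemeasurable
    have h2 := integral_map hj (f := fun x : ℝ => x) (by fun_prop)
    have h3 : γ.map (fun x : Fin n → ℝ => x j) = expMeasure 1 :=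
      (measurePreserving_eval (fun _ : Fin n => expMeasure 1) j).map_eq
    rw [← h2, h3, integral_id_expMeasure, mul_one]
  have hvar : ∫ x, Y x ^ 2 ∂γ = 1 := by
    have h1 := variance_eq_sub hYL
    rw [hmean] at h1
    have h2 := variance_sum_pi (μ := fun _ : Fin n => expMeasure 1) hX
    have h3 : (∑ i : Fin n, fun ω : Fin n → ℝ => a i * ω i) = Y := by
      ext x
      simp [hY]
    rw [h3, ← hγ, h1] at h2
    have h4 : ∀ i, variance (fun x : ℝ => a i * x) (expMeasure 1) = a i ^ 2 := fun i => by
      rw [variance_const_mul, variance_id_expMeasure, mul_one]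
    simp only [h4, hsq] at h2
    simpa using h2
  have hmap : ∀ s : Set ℝ, MeasurableSet s → (γ.map Y) s = γ (Y ⁻¹' s) := fun s hs =>
    Measure.map_apply hYm hs
  have key := sq_measure_Ioc_le_of_isFourPoint (γ.map Y) ?_ ?_
    ((integrable_map_measure (by fun_prop) hYm.aemeasurable).2 hYint)
    (by rw [integral_map hYm.aemeasurable (by fun_prop), hmean])
    ((integrable_map_measure (by fun_prop) hYm.aemeasurable).2 hYL.integrable_sq)
    (by rw [integral_map hYm.aemeasurable (by fun_prop), hvar]) hε
  · rw [map_measureReal_apply hYm measurableSet_Ioc] at key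
    exact key
  · convert isFourPoint_lintegral_pi_expMeasure a
      (measurable_one.indicator measurableSet_Iio) IsFourPoint.indicator_Iio using 2 with t
    rw [hmap _ measurableSet_Ioi, ← lintegral_indicator_one (hYm measurableSet_Ioi)]
    refine lintegral_congr fun x => ?_
    simp [indicator, hY]
  · convert isFourPoint_lintegral_pi_expMeasure a
      (measurable_one.indicator measurableSet_Ici) IsFourPoint.indicator_Ici using 2 with t
    rw [hmap _ measurableSet_Iic, ← lintegral_indicator_one (hYm measurableSet_Iic)]
    refine lintegral_congr fun x => ?_
    simp [indicator, hY]

/-! ### The product exponential law as a mixture of solid simplices. -/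

theorem MeasureTheory.Measure.pi_withDensity_ofReal {ι : Type*} [Fintype ι] (f : ℝ → ℝ)
    (hf0 : ∀ x, 0 ≤ f x) (hfi : Integrable f)
    [SigmaFinite ((volume : Measure ℝ).withDensity fun x => ENNReal.ofReal (f x))] :
    (Measure.pi fun _ : ι => (volume : Measure ℝ).withDensity fun x => ENNReal.ofReal (f x)) =
      (volume : Measure (ι → ℝ)).withDensity fun x => ENNReal.ofReal (∏ i, f (x i)) := by
  refine Measure.pi_eq fun s hs => ?_
  rw [withDensity_apply _ (MeasurableSet.univ_pi hs), volume_pi, Measure.restrict_pi_pi,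
    ← ofReal_integral_eq_lintegral_ofReal (Integrable.fintype_prod fun i => hfi.restrict)
      (Filter.Eventually.of_forall fun x => Finset.prod_nonneg fun i _ => hf0 _),
    integral_fintype_prod_eq_prod, ENNReal.ofReal_prod_of_nonneg fun i _ =>
      integral_nonneg hf0]
  refine Finset.prod_congr rfl fun i _ => ?_
  rw [withDensity_apply _ (hs i), ofReal_integral_eq_lintegral_ofReal hfi.restrict
    (Filter.Eventually.of_forall hf0)]

theorem setLIntegral_Ici_exp_neg (t : ℝ) :
    ∫⁻ s in Ici t, ENNReal.ofReal (Real.exp (-s)) = ENNReal.ofReal (Real.exp (-t)) := by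
  rw [setLIntegral_congr Ioi_ae_eq_Ici.symm, ← integral_exp_neg_Ioi,
    ofReal_integral_eq_lintegral_ofReal (integrableOn_exp_neg_Ioi t)
      (Filter.Eventually.of_forall fun x => by positivity)]

/-- Layer-cake formula for the product of standard exponential distributions. -/
theorem pi_expMeasure_apply {ι : Type*} [Fintype ι] {S : Set (ι → ℝ)} (hS : MeasurableSet S) :
    (Measure.pi fun _ : ι => expMeasure 1) S =
      ∫⁻ s in Ici (0 : ℝ), ENNReal.ofReal (Real.exp (-s)) *
        volume (S ∩ {x | (∀ j, 0 ≤ x j) ∧ ∑ j, x j ≤ s}) := by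
  have hprob : IsProbabilityMeasure (expMeasure 1) := isProbabilityMeasure_expMeasure one_pos
  set f : ℝ → ℝ := gammaPDFReal 1 1 with hf
  have hform : ∀ x, f x = if 0 ≤ x then Real.exp (-x) else 0 := by
    intro x
    simp [hf, gammaPDFReal]
  have hf0 : ∀ x, 0 ≤ f x := fun x => by
    rw [hform]; split_ifs <;> positivity
  have hfm : Measurable f := measurable_gammaPDFReal 1 1
  have hexp : expMeasure 1 = volume.withDensity fun x => ENNReal.ofReal (f x) := rfl
  have hfi : Integrable f := by
    refine ⟨hfm.aestronglyMeasurable, ?_⟩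
    rw [hasFiniteIntegral_iff_ofReal (Filter.Eventually.of_forall hf0)]
    have : (expMeasure 1) univ = 1 := measure_univ
    rw [hexp, withDensity_apply _ MeasurableSet.univ, Measure.restrict_univ] at this
    rw [this]
    exact ENNReal.one_lt_top
  have : SigmaFinite ((volume : Measure ℝ).withDensity fun x => ENNReal.ofReal (f x)) := by
    rw [← hexp]; infer_instance
  have horth : MeasurableSet {x : ι → ℝ | ∀ j, 0 ≤ x j} := by measurability
  -- On the orthant the density is `exp (-∑ x_i)`, which is the integral of `exp (-s)` over `s ≥ ∑
  -- x_i`.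
  have hprod : ∀ x : ι → ℝ, ENNReal.ofReal (∏ i, f (x i)) =
      ∫⁻ s in Ici (0 : ℝ), ENNReal.ofReal (Real.exp (-s)) *
        indicator {x : ι → ℝ | (∀ j, 0 ≤ x j) ∧ ∑ j, x j ≤ s} 1 x := by
    intro x
    by_cases hx : ∀ j, 0 ≤ x j
    · have h1 : ∏ i, f (x i) = Real.exp (-∑ i, x i) := by
        rw [← Finset.sum_neg_distrib, Real.exp_sum]
        exact Finset.prod_congr rfl fun i _ => by rw [hform, if_pos (hx i)]
      have h2 : 0 ≤ ∑ i, x i := Finset.sum_nonneg fun i _ => hx i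
      rw [h1, ← setLIntegral_Ici_exp_neg, ← lintegral_indicator measurableSet_Ici,
        ← lintegral_indicator measurableSet_Ici]
      refine lintegral_congr fun s => ?_
      by_cases hs : ∑ i, x i ≤ s
      · simp [indicator, hs, h2.trans hs, hx]
      · simp [indicator, hs]
    · have h1 : ∏ i, f (x i) = 0 := by
        push Not at hx
        obtain ⟨j, hj⟩ := hx
        exact Finset.prod_eq_zero (Finset.mem_univ j) (by rw [hform, if_neg hj.not_ge])
      simp [h1, indicator, hx]
  rw [hexp, Measure.pi_withDensity_ofReal f hf0 hfi, withDensity_apply _ hS]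
  simp_rw [hprod]
  have hset : MeasurableSet {p : (ι → ℝ) × ℝ | (∀ j, 0 ≤ p.1 j) ∧ ∑ j, p.1 j ≤ p.2} := by
    refine (horth.preimage measurable_fst).inter (measurableSet_le ?_ measurable_snd)
    fun_prop
  rw [lintegral_lintegral_swap (f := fun (x : ι → ℝ) (s : ℝ) => ENNReal.ofReal (Real.exp (-s)) *
    indicator {x : ι → ℝ | (∀ j, 0 ≤ x j) ∧ ∑ j, x j ≤ s} 1 x)]
  · refine lintegral_congr fun s => ?_
    have hle : MeasurableSet {x : ι → ℝ | ∑ j, x j ≤ s} :=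
      measurableSet_le (by fun_prop) measurable_const
    have hms : MeasurableSet {x : ι → ℝ | (∀ j, 0 ≤ x j) ∧ ∑ j, x j ≤ s} :=
      horth.inter hle
    rw [lintegral_const_mul _ (measurable_one.indicator hms), lintegral_indicator_one hms,
      Measure.restrict_apply hms, inter_comm]
  · have : Function.uncurry (fun (x : ι → ℝ) (s : ℝ) => ENNReal.ofReal (Real.exp (-s)) *
        indicator {x : ι → ℝ | (∀ j, 0 ≤ x j) ∧ ∑ j, x j ≤ s} 1 x) = fun p =>
        ENNReal.ofReal (Real.exp (-p.2)) *
        indicator {p : (ι → ℝ) × ℝ | (∀ j, 0 ≤ p.1 j) ∧ ∑ j, p.1 j ≤ p.2} 1 p := by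
      ext p
      simp [Function.uncurry, indicator]
    rw [this]
    have hexpm : Measurable fun p : (ι → ℝ) × ℝ => ENNReal.ofReal (Real.exp (-p.2)) := by fun_prop
    exact (hexpm.mul (measurable_one.indicator hset)).aemeasurable

/-! ### Volumes of cones and oblique cylinders by slicing. -/

section Slicing

variable {E : Type*} [NormedAddCommGroup E] [InnerProductSpace ℝ E] [MeasurableSpace E]
  [BorelSpace E]

/-- Slicing a subset of a subspace by the hyperplanes orthogonal to a unit vector. -/
theorem euclideanHausdorffMeasure_eq_lintegral_inner {W : Submodule ℝ E} [FiniteDimensional ℝ W]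
    {d : ℕ} (hd : finrank ℝ W = d + 1) {u : E} (hu : u ∈ W) (hu1 : ‖u‖ = 1) {A : Set E}
    (hA : MeasurableSet A) (hAW : A ⊆ W) :
    μHE[d + 1] A = ∫⁻ t : ℝ, μHE[d] (A ∩ {y | inner ℝ u y = t}) := by
  have himg : ∀ B ⊆ A, (Subtype.val '' (Subtype.val ⁻¹' B : Set W)) = B := fun B hB =>
    (Subtype.image_preimage_coe (W : Set E) B).trans (inter_eq_right.2 (hB.trans hAW))
  have hv : (⟨u, hu⟩ : W) ≠ 0 := by
    intro h
    have : u = 0 := congrArg Subtype.val h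
    simp [this] at hu1
  have key := EuclideanGeometry.euclideanHausdorffMeasure_eq_lintegral (0 : W) hv
    (hA.preimage measurable_subtype_coe)
  have hnorm : ‖(⟨u, hu⟩ : W)‖ₑ = 1 := by
    rw [← ofReal_norm, Submodule.coe_norm, hu1, ENNReal.ofReal_one]
  rw [hd, hnorm, one_mul] at key
  rw [← himg A subset_rfl, isometry_subtype_coe.euclideanHausdorffMeasure_image,
    himg A subset_rfl, key]
  refine lintegral_congr fun t => ?_
  rw [← isometry_subtype_coe.euclideanHausdorffMeasure_image, Nat.add_sub_cancel]
  congr 1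
  have : inner ℝ u u = 1 := by rw [real_inner_self_eq_norm_sq, hu1, one_pow]
  ext y
  constructor
  · rintro ⟨z, ⟨hz, hz'⟩, rfl⟩
    refine ⟨hz, ?_⟩
    rw [SetLike.mem_coe, AffineSubspace.mem_mk', Submodule.mem_orthogonal_singleton_iff_inner_right]
      at hz'
    simp only [vadd_eq_add, add_zero, vsub_eq_sub, inner_sub_right, inner_smul_right,
      Submodule.coe_inner] at hz'
    rw [this] at hz'
    simp only [mem_ofPred_eq]
    linarith
  · rintro ⟨hy, hy'⟩
    refine ⟨⟨y, hAW hy⟩, ⟨hy, ?_⟩, rfl⟩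
    rw [SetLike.mem_coe, AffineSubspace.mem_mk', Submodule.mem_orthogonal_singleton_iff_inner_right]
    simp only [vadd_eq_add, add_zero, vsub_eq_sub, inner_sub_right, inner_smul_right,
      Submodule.coe_inner]
    rw [this]
    simp only [mem_ofPred_eq] at hy'
    linarith

/-- The cone with apex `0`, without its apex, over a subset `B` of the hyperplane
`{y | ⟪w, y⟫ = h}`. -/
def coneOver (w : E) (h : ℝ) (B : Set E) : Set E :=
  {y | 0 < inner ℝ w y ∧ inner ℝ w y ≤ h ∧ (h / inner ℝ w y) • y ∈ B}

theorem measurableSet_coneOver [SecondCountableTopology E] (w : E) (h : ℝ) {B : Set E}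
    (hB : MeasurableSet B) : MeasurableSet (coneOver w h B) := by
  have h1 : Measurable fun y : E => inner ℝ w y := by fun_prop
  exact (measurableSet_lt measurable_const h1).inter
    ((measurableSet_le h1 measurable_const).inter
      (hB.preimage ((measurable_const.div h1).smul measurable_id)))

theorem setLIntegral_Ioc_div_pow {H : ℝ} (hH : 0 < H) (d : ℕ) :
    ∫⁻ t in Ioc 0 H, ENNReal.ofReal ((t / H) ^ d) = ENNReal.ofReal (H / (d + 1)) := by
  rw [← ofReal_integral_eq_lintegral_ofReal]
  · rw [← intervalIntegral.integral_of_le hH.le]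
    simp_rw [div_pow]
    rw [intervalIntegral.integral_div, integral_pow]
    congr 1
    rw [zero_pow (by positivity), sub_zero, pow_succ]
    field_simp
  · exact (Continuous.integrableOn_Icc (by fun_prop)).mono_set Ioc_subset_Icc_self
  · filter_upwards [ae_restrict_mem measurableSet_Ioc] with t ht
    have := ht.1
    positivity

open scoped Pointwise in
/-- Volume of a cone: height times base over the dimension. -/
theorem euclideanHausdorffMeasure_coneOver [SecondCountableTopology E] {W : Submodule ℝ E}
    [FiniteDimensional ℝ W]
    {d : ℕ} (hd : finrank ℝ W = d + 1) {w : E} (hw : w ∈ W) {h : ℝ} (hh : 0 < h)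
    {B : Set E} (hB : MeasurableSet B) (hBW : B ⊆ W) (hBh : ∀ y ∈ B, inner ℝ w y = h) :
    ENNReal.ofReal h * μHE[d] B = ENNReal.ofReal ((d + 1) * ‖w‖) * μHE[d + 1] (coneOver w h B) := by
  rcases B.eq_empty_or_nonempty with rfl | ⟨b, hb⟩
  · simp [coneOver]
  have hw0 : 0 < ‖w‖ := by
    rw [norm_pos_iff]
    rintro rfl
    have := hBh b hb
    rw [inner_zero_left] at this
    exact hh.ne this
  -- `H` is the Euclidean height of the cone; its slice at distance `t` from the apex is `(t / H) •
  -- B`.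
  set H := h / ‖w‖ with hH
  have hHpos : 0 < H := by positivity
  have hu1 : ‖(‖w‖⁻¹ • w)‖ = 1 := by
    rw [norm_smul, norm_inv, norm_norm, inv_mul_cancel₀ hw0.ne']
  have hsub : coneOver w h B ⊆ W := by
    rintro y ⟨hy1, hy2, hy3⟩
    have := W.smul_mem (h / inner ℝ w y)⁻¹ (hBW hy3)
    rwa [inv_smul_smul₀ (by positivity)] at this
  rw [euclideanHausdorffMeasure_eq_lintegral_inner hd (W.smul_mem _ hw) hu1
    (measurableSet_coneOver w h hB) hsub]
  have hslice : ∀ t : ℝ, μHE[d] (coneOver w h B ∩ {y | inner ℝ (‖w‖⁻¹ • w) y = t}) =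
      (Ioc 0 H).indicator (fun t => ENNReal.ofReal ((t / H) ^ d) * μHE[d] B) t := by
    intro t
    have hlev : ∀ y, inner ℝ (‖w‖⁻¹ • w) y = t ↔ inner ℝ w y = t * ‖w‖ := by
      intro y
      rw [real_inner_smul_left]
      constructor
      · rintro rfl
        field_simp
      · intro h
        rw [h]
        field_simp
    by_cases ht : t ∈ Ioc 0 H
    · rw [indicator_of_mem ht]
      have h0 := ht.1
      have hset : coneOver w h B ∩ {y | inner ℝ (‖w‖⁻¹ • w) y = t} = (t / H) • B := by
        ext y
        rw [mem_smul_set_iff_inv_smul_mem₀ (by positivity)]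
        have e : (t / H)⁻¹ = h / (t * ‖w‖) := by
          rw [hH]; field_simp
        constructor
        · rintro ⟨⟨_, _, hy⟩, hyt⟩
          rw [mem_ofPred_eq, hlev] at hyt
          rw [e, ← hyt]
          exact hy
        · intro hy
          have h1 := hBh _ hy
          rw [inner_smul_right, e, div_mul_eq_mul_div, div_eq_iff (by positivity),
            mul_right_inj' hh.ne'] at h1
          refine ⟨⟨?_, ?_, ?_⟩, (hlev y).2 h1⟩
          · rw [h1]
            positivity
          · rw [h1]
            exact (le_div_iff₀ hw0).1 ht.2
          · rw [h1, ← e]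
            exact hy
      rw [hset, Measure.euclideanHausdorffMeasure_smul₀ _ (by positivity)]
      rw [ENNReal.smul_def, smul_eq_mul, ENNReal.coe_pow, ENNReal.ofReal_pow (by positivity)]
      congr 2
      rw [← Real.enorm_of_nonneg (by positivity)]
      rfl
    · rw [indicator_of_notMem ht]
      convert measure_empty (μ := (μHE[d] : Measure E)) using 2
      rw [eq_empty_iff_forall_notMem]
      rintro y ⟨⟨h1, h2, _⟩, hyt⟩
      rw [mem_ofPred_eq, hlev] at hyt
      rw [hyt] at h1 h2
      exact ht ⟨pos_of_mul_pos_left h1 hw0.le, (le_div_iff₀ hw0).2 h2⟩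
  simp_rw [hslice]
  rw [lintegral_indicator measurableSet_Ioc, lintegral_mul_const _ (by fun_prop),
    setLIntegral_Ioc_div_pow hHpos, ← mul_assoc, ← ENNReal.ofReal_mul (by positivity)]
  congr 2
  rw [hH]
  field_simp

/-- Volume of the oblique cylinder with base `A` in the hyperplane `{y | ⟪u, y⟫ = 0}`. -/
theorem euclideanHausdorffMeasure_cylinder [SecondCountableTopology E] [FiniteDimensional ℝ E]
    {d : ℕ} (hd : finrank ℝ E = d + 1) {u v : E} (hu1 : ‖u‖ = 1) (huv : inner ℝ u v = 1)
    {A : Set E} (hA : MeasurableSet A) (hAu : ∀ y ∈ A, inner ℝ u y = 0) (c : ℝ) :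
    μHE[d + 1] {x | 0 < inner ℝ u x ∧ inner ℝ u x ≤ c ∧ x - (inner ℝ u x) • v ∈ A} =
      ENNReal.ofReal c * μHE[d] A := by
  have h1 : Measurable fun y : E => inner ℝ u y := by fun_prop
  have hm : MeasurableSet {x | 0 < inner ℝ u x ∧ inner ℝ u x ≤ c ∧ x - (inner ℝ u x) • v ∈ A} :=
    (measurableSet_lt measurable_const h1).inter
    ((measurableSet_le h1 measurable_const).inter
      (hA.preimage (measurable_id.sub (h1.smul measurable_const))))
  rw [euclideanHausdorffMeasure_eq_lintegral_inner (W := ⊤) (by rwa [finrank_top])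
    Submodule.mem_top hu1 hm (fun _ _ => Submodule.mem_top)]
  have hslice : ∀ t : ℝ, μHE[d] ({x | 0 < inner ℝ u x ∧ inner ℝ u x ≤ c ∧
      x - (inner ℝ u x) • v ∈ A} ∩ {y | inner ℝ u y = t}) =
      (Ioc 0 c).indicator (fun _ => μHE[d] A) t := by
    intro t
    by_cases ht : t ∈ Ioc 0 c
    · rw [indicator_of_mem ht, ← measure_preimage_add_right μHE[d] (-(t • v)) A]
      congr 1
      ext x
      constructor
      · rintro ⟨⟨_, _, hx⟩, hxt⟩
        rw [mem_ofPred_eq] at hxt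
        rw [hxt] at hx
        simpa [sub_eq_add_neg] using hx
      · intro hx
        have h2 := hAu _ hx
        rw [inner_add_right, inner_neg_right, inner_smul_right, huv] at h2
        have hxt : inner ℝ u x = t := by linarith
        refine ⟨⟨?_, ?_, ?_⟩, hxt⟩
        · rw [hxt]; exact ht.1
        · rw [hxt]; exact ht.2
        · rw [hxt]
          simpa [sub_eq_add_neg] using hx
    · rw [indicator_of_notMem ht]
      convert measure_empty (μ := (μHE[d] : Measure E)) using 2
      rw [eq_empty_iff_forall_notMem]
      rintro y ⟨⟨h1, h2, _⟩, hyt⟩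
      rw [mem_ofPred_eq] at hyt
      rw [hyt] at h1 h2
      exact ht ⟨h1, h2⟩
  simp_rw [hslice]
  rw [lintegral_indicator measurableSet_Ioc, setLIntegral_const, Real.volume_Ioc, sub_zero,
    mul_comm]

end Slicing

/-! ### Volume of central sections of the simplex. -/

section SimplexSection

variable {m : ℕ}

theorem measurableSet_nonneg (m : ℕ) :
    MeasurableSet {x : EuclideanSpace ℝ (Fin m) | ∀ j, 0 ≤ x j} := by
  have : {x : EuclideanSpace ℝ (Fin m) | ∀ j, 0 ≤ x j} = ⋂ j, {x | 0 ≤ x j} := by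
    ext; simp
  rw [this]
  exact MeasurableSet.iInter fun j => measurableSet_le measurable_const (by fun_prop)

theorem exists_pos_of_sum_eq_zero {a : EuclideanSpace ℝ (Fin m)} (ha : ‖a‖ = 1)
    (hsum : ∑ j, a j = 0) : ∃ i, 0 < a i := by
  by_contra! h
  have h0 := (Finset.sum_eq_zero_iff_of_nonpos fun i _ => h i).1 hsum
  have : a = 0 := by
    ext i
    exact h0 i (Finset.mem_univ i)
  simp [this] at ha

theorem inner_eq_sum_mul (a x : EuclideanSpace ℝ (Fin m)) : inner ℝ a x = ∑ j, a j * x j := by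
  simp [PiLp.inner_apply, mul_comm]

open scoped Pointwise in
-- Pushing the points of `r • C` along `e_i / a_i` by lengths `t ∈ (0, ε]` keeps coordinates
-- nonnegative, raises `⟨a, x⟩` to `t`, and raises `∑ x_j` by at most `ε / a_i`. The resulting
-- oblique cylinder has volume `ε r^n` times that of `C`; integrating it against `exp (-(r + ε /
-- a_i))` produces `n!` and the factor `exp (-(ε / a_i))`, which tends to 1.
theorem mul_euclideanHausdorffMeasure_le_pi_expMeasure {n : ℕ}
    {a : EuclideanSpace ℝ (Fin (n + 1))} (ha : ‖a‖ = 1) {i : Fin (n + 1)} (hi : 0 < a i) {ε : ℝ}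
    (hε : 0 < ε) :
    ENNReal.ofReal (ε * Real.exp (-(ε / a i))) *
        ((n ! : ℕ) * μHE[n] {x : EuclideanSpace ℝ (Fin (n + 1)) |
          ((∀ j, 0 ≤ x j) ∧ ∑ j, x j ≤ 1) ∧ inner ℝ a x = 0}) ≤
      (Measure.pi fun _ : Fin (n + 1) => expMeasure 1)
        {x | 0 < ∑ j, a j * x j ∧ ∑ j, a j * x j ≤ ε} := by
  set C := {x : EuclideanSpace ℝ (Fin (n + 1)) |
    ((∀ j, 0 ≤ x j) ∧ ∑ j, x j ≤ 1) ∧ inner ℝ a x = 0} with hC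
  have hsumm : Measurable fun x : EuclideanSpace ℝ (Fin (n + 1)) => ∑ j, x j := by fun_prop
  have hinnm : Measurable fun x : EuclideanSpace ℝ (Fin (n + 1)) => inner ℝ a x := by fun_prop
  have hCm : MeasurableSet C := ((measurableSet_nonneg _).inter
    (measurableSet_le hsumm measurable_const)).inter (measurableSet_eq_fun hinnm measurable_const)
  have hlin : Measurable fun x : Fin (n + 1) → ℝ => ∑ j, a j * x j := by fun_prop
  have hsm : Measurable fun x : Fin (n + 1) → ℝ => ∑ j, x j := by fun_prop
  have hSm : MeasurableSet {x : Fin (n + 1) → ℝ | 0 < ∑ j, a j * x j ∧ ∑ j, a j * x j ≤ ε} :=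
    (measurableSet_lt measurable_const hlin).inter (measurableSet_le hlin measurable_const)
  rw [pi_expMeasure_apply hSm, setLIntegral_congr Ioi_ae_eq_Ici.symm]
  set δ := ε / a i with hδ
  have hδ0 : 0 < δ := by positivity
  have hslice : ∀ r ∈ Ioi (0 : ℝ), ENNReal.ofReal ε * (ENNReal.ofReal (r ^ n) * μHE[n] C) ≤
      volume ({x : Fin (n + 1) → ℝ | 0 < ∑ j, a j * x j ∧ ∑ j, a j * x j ≤ ε} ∩
        {x | (∀ j, 0 ≤ x j) ∧ ∑ j, x j ≤ r + δ}) := by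
    intro r hr
    have hr : 0 < r := hr
    have horthm : MeasurableSet {x : Fin (n + 1) → ℝ | ∀ j, 0 ≤ x j} := by
      have : {x : Fin (n + 1) → ℝ | ∀ j, 0 ≤ x j} = ⋂ j, {x | 0 ≤ x j} := by
        ext; simp
      rw [this]
      exact MeasurableSet.iInter fun j => measurableSet_le measurable_const (by fun_prop)
    have hm := hSm.inter (horthm.inter (measurableSet_le hsm (measurable_const (a := r + δ))))
    have hvol := (PiLp.volume_preserving_ofLp (Fin (n + 1))).measure_preimage hm.nullMeasurableSet
    rw [← EuclideanSpace.euclideanHausdorffMeasure_eq_volume] at hvol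
    set Q := {x : EuclideanSpace ℝ (Fin (n + 1)) | 0 < inner ℝ a x ∧ inner ℝ a x ≤ ε ∧
        x - (inner ℝ a x) • ((a i)⁻¹ • EuclideanSpace.single i (1 : ℝ)) ∈ r • C} with hQ
    refine le_trans (le_of_eq (b := μHE[n + 1] Q) ?_) ((measure_mono ?_).trans hvol.le)
    rotate_left
    · rintro x ⟨h1, h2, h3⟩
      rw [mem_smul_set_iff_inv_smul_mem₀ hr.ne'] at h3
      obtain ⟨⟨h4, h5⟩, -⟩ := h3
      set t := inner ℝ a x with ht
      have h6 : ∀ j, x j = r * (r⁻¹ • (x - t • ((a i)⁻¹ • EuclideanSpace.single i (1 : ℝ)))) j +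
          t * ((a i)⁻¹ * (EuclideanSpace.single i (1 : ℝ) : EuclideanSpace ℝ (Fin (n + 1))) j) := by
        intro j
        simp only [PiLp.smul_apply, PiLp.sub_apply, smul_eq_mul]
        rw [mul_inv_cancel_left₀ hr.ne']
        ring
      refine ⟨?_, ?_, ?_⟩
      · have : ∑ j, a j * x j = t := by rw [ht, inner_eq_sum_mul]
        exact ⟨by rw [this]; exact h1, by rw [this]; exact h2⟩
      · intro j
        rw [h6 j]
        have : 0 ≤ (EuclideanSpace.single i (1 : ℝ) : EuclideanSpace ℝ (Fin (n + 1))) j := by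
          rw [PiLp.single_apply]
          split_ifs <;> norm_num
        have := h4 j
        positivity
      · have : ∑ j, x j = r * ∑ j,
            (r⁻¹ • (x - t • ((a i)⁻¹ • EuclideanSpace.single i (1 : ℝ)))) j + t * (a i)⁻¹ := by
          rw [Finset.sum_congr rfl fun j _ => h6 j, Finset.sum_add_distrib, ← Finset.mul_sum,
            ← Finset.mul_sum, ← Finset.mul_sum]
          simp
        change ∑ j, x j ≤ r + δ
        rw [this]
        refine add_le_add (mul_le_of_le_one_right hr.le h5) ?_
        rw [hδ, div_eq_mul_inv]
        gcongr
    · rw [hQ, euclideanHausdorffMeasure_cylinder finrank_euclideanSpace_fin ha (by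
          rw [inner_smul_right, EuclideanSpace.inner_single_right]
          simp [hi.ne']) (hCm.const_smul₀ r) (by
          intro y hy
          rw [mem_smul_set_iff_inv_smul_mem₀ hr.ne'] at hy
          have := hy.2
          rw [inner_smul_right] at this
          simpa [hr.ne'] using this), Measure.euclideanHausdorffMeasure_smul₀ _ hr.ne',
          ENNReal.smul_def, smul_eq_mul, ENNReal.coe_pow, ENNReal.ofReal_pow hr.le]
      congr 3
      rw [← Real.enorm_of_nonneg hr.le]
      rfl
  calc ENNReal.ofReal (ε * Real.exp (-δ)) * ((n ! : ℕ) * μHE[n] C)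
      = ∫⁻ r in Ioi (0 : ℝ), ENNReal.ofReal (Real.exp (-(r + δ))) *
          (ENNReal.ofReal ε * (ENNReal.ofReal (r ^ n) * μHE[n] C)) := by
        rw [← setLIntegral_Ici_exp_neg_mul_pow n, setLIntegral_congr Ioi_ae_eq_Ici.symm,
          ← lintegral_mul_const _ (by fun_prop), ← lintegral_const_mul _ (by fun_prop)]
        refine lintegral_congr fun r => ?_
        rw [neg_add, Real.exp_add, ENNReal.ofReal_mul (by positivity),
          ENNReal.ofReal_mul (by positivity)]
        ring
    _ ≤ ∫⁻ r in Ioi (0 : ℝ), ENNReal.ofReal (Real.exp (-(r + δ))) *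
          volume ({x : Fin (n + 1) → ℝ | 0 < ∑ j, a j * x j ∧ ∑ j, a j * x j ≤ ε} ∩
        {x | (∀ j, 0 ≤ x j) ∧ ∑ j, x j ≤ r + δ}) := by
        refine setLIntegral_mono' measurableSet_Ioi fun r hr => ?_
        gcongr
        exact hslice r hr
    _ = ∫⁻ s in Ioi (0 + δ), ENNReal.ofReal (Real.exp (-s)) *
          volume ({x : Fin (n + 1) → ℝ | 0 < ∑ j, a j * x j ∧ ∑ j, a j * x j ≤ ε} ∩
        {x | (∀ j, 0 ≤ x j) ∧ ∑ j, x j ≤ s}) := by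
        rw [IsFourPoint.setLIntegral_Ioi_add]
    _ ≤ _ := lintegral_mono_set (Ioi_subset_Ioi (by linarith))

/-- The volume of a central hyperplane section of the cone over the simplex. -/
theorem euclideanHausdorffMeasure_central_section_cone_le {n : ℕ}
    {a : EuclideanSpace ℝ (Fin (n + 1))} (ha : ‖a‖ = 1) (hsum : ∑ j, a j = 0) :
    (n ! : ℕ) * μHE[n] {x : EuclideanSpace ℝ (Fin (n + 1)) |
          ((∀ j, 0 ≤ x j) ∧ ∑ j, x j ≤ 1) ∧ inner ℝ a x = 0} ≤
      ENNReal.ofReal (1 / Real.sqrt 2) := by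
  have hprob : IsProbabilityMeasure (expMeasure 1) := isProbabilityMeasure_expMeasure one_pos
  obtain ⟨i, hi⟩ := exists_pos_of_sum_eq_zero ha hsum
  set K := (n ! : ℕ) * μHE[n] {x : EuclideanSpace ℝ (Fin (n + 1)) |
          ((∀ j, 0 ≤ x j) ∧ ∑ j, x j ≤ 1) ∧ inner ℝ a x = 0} with hK
  have hbound := fun (ε : ℝ) (hε : 0 < ε) => mul_euclideanHausdorffMeasure_le_pi_expMeasure ha hi hε
  rw [← hK] at hbound
  -- Finiteness comes from the same estimate at `ε = 1`, a probability being finite.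
  have hKne : K ≠ ∞ := by
    intro h
    have := hbound 1 one_pos
    rw [h, ENNReal.mul_top (by simp; positivity)] at this
    exact (measure_lt_top _ _).ne (top_le_iff.1 this)
  have hsq : ∑ j, a j ^ 2 = 1 := by
    rw [← EuclideanSpace.real_norm_sq_eq, ha, one_pow]
  have hε : ∀ ε ∈ Ioi (0 : ℝ), (Real.exp (-(ε / a i)) * K.toReal) ^ 2 ≤ 1 / 2 + 4 * ε := by
    intro ε hε
    have hε : 0 < ε := hε
    have h1 := ENNReal.toReal_mono (measure_ne_top _ _) (hbound ε hε)
    rw [ENNReal.toReal_mul, ENNReal.toReal_ofReal (by positivity)] at h1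
    have h2 := (pow_le_pow_left₀ (by positivity) h1 2).trans (sq_pi_expMeasure_le (fun j => a j)
      hsum hsq hε)
    have h3 : ε ^ 2 * (Real.exp (-(ε / a i)) * K.toReal) ^ 2 ≤ ε ^ 2 * (1 / 2 + 4 * ε) := by
      rw [mul_pow] at h2
      linarith [h2, mul_pow ε (Real.exp (-(ε / a i)) * K.toReal) 2]
    exact le_of_mul_le_mul_left h3 (by positivity)
  have hlim1 : Filter.Tendsto (fun ε : ℝ => (Real.exp (-(ε / a i)) * K.toReal) ^ 2)
      (nhdsWithin 0 (Ioi 0)) (nhds (K.toReal ^ 2)) := by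
    have : Continuous fun ε : ℝ => (Real.exp (-(ε / a i)) * K.toReal) ^ 2 := by fun_prop
    have h := (this.tendsto 0).mono_left (nhdsWithin_le_nhds (s := Ioi 0))
    simpa using h
  have hlim2 : Filter.Tendsto (fun ε : ℝ => 1 / 2 + 4 * ε)
      (nhdsWithin 0 (Ioi 0)) (nhds (1 / 2)) := by
    have : Continuous fun ε : ℝ => 1 / 2 + 4 * ε := by fun_prop
    have h := (this.tendsto 0).mono_left (nhdsWithin_le_nhds (s := Ioi 0))
    simpa using h
  have hfin := le_of_tendsto_of_tendsto hlim1 hlim2 (by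
    filter_upwards [self_mem_nhdsWithin] with ε h using hε ε h)
  rw [← ENNReal.ofReal_toReal hKne]
  refine ENNReal.ofReal_le_ofReal ?_
  have : (1 / Real.sqrt 2) ^ 2 = 1 / 2 := by
    rw [div_pow, Real.sq_sqrt (by norm_num), one_pow]
  rw [← this] at hfin
  exact (pow_le_pow_iff_left₀ ENNReal.toReal_nonneg (by positivity) two_ne_zero).1 hfin

/-- The central section of the simplex orthogonal to `a`. -/
def centralSection {m : ℕ} (a : EuclideanSpace ℝ (Fin m)) : Set (EuclideanSpace ℝ (Fin m)) :=
  {x | ((∀ j, 0 ≤ x j) ∧ ∑ j, x j = 1) ∧ inner ℝ a x = 0}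

theorem measurableSet_centralSection (a : EuclideanSpace ℝ (Fin m)) :
    MeasurableSet (centralSection a) := by
  have hsumm : Measurable fun x : EuclideanSpace ℝ (Fin m) => ∑ j, x j := by fun_prop
  have hinnm : Measurable fun x : EuclideanSpace ℝ (Fin m) => inner ℝ a x := by fun_prop
  exact ((measurableSet_nonneg _).inter
    (measurableSet_eq_fun hsumm measurable_const)).inter
    (measurableSet_eq_fun hinnm measurable_const)

/-- The vector all of whose coordinates are `1`. -/
def onesVector (m : ℕ) : EuclideanSpace ℝ (Fin m) := WithLp.toLp 2 fun _ => 1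

theorem inner_onesVector (x : EuclideanSpace ℝ (Fin m)) :
    inner ℝ (onesVector m) x = ∑ j, x j := by
  simp [inner_eq_sum_mul, onesVector]

theorem norm_onesVector (m : ℕ) : ‖onesVector m‖ = Real.sqrt m := by
  simp [EuclideanSpace.norm_eq, onesVector]

/-- Webb's bound for central hyperplane sections of the regular simplex. -/
theorem euclideanHausdorffMeasure_centralSection_le {m : ℕ}
    {a : EuclideanSpace ℝ (Fin (m + 2))} (ha : ‖a‖ = 1) (hsum : ∑ j, a j = 0) :
    μHE[m] (centralSection a) ≤
      ENNReal.ofReal (Real.sqrt (m + 2) / (Real.sqrt 2 * (m ! : ℕ))) := by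
  have ha0 : a ≠ 0 := by
    rintro rfl
    simp at ha
  have hfin : finrank ℝ ((ℝ ∙ a)ᗮ : Submodule ℝ _) = m + 1 := by
    have : Fact (finrank ℝ (EuclideanSpace ℝ (Fin (m + 2))) = (m + 1) + 1) :=
      ⟨finrank_euclideanSpace_fin⟩
    exact Submodule.finrank_orthogonal_span_singleton ha0
  -- Inside `a^⊥`, the cone from the origin over the central section has height `1 / √(m + 2)` and
  -- lies in the cut solid simplex.
  have hcone := euclideanHausdorffMeasure_coneOver hfin (w := onesVector (m + 2)) (h := 1)
    (by rw [Submodule.mem_orthogonal_singleton_iff_inner_right, real_inner_comm,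
      inner_onesVector, hsum]) one_pos (measurableSet_centralSection a)
    (fun x hx => Submodule.mem_orthogonal_singleton_iff_inner_right.2 hx.2)
    (fun x hx => by rw [inner_onesVector, hx.1.2])
  have hsub : coneOver (onesVector (m + 2)) 1 (centralSection a) ⊆
      {x : EuclideanSpace ℝ (Fin (m + 2)) |
          ((∀ j, 0 ≤ x j) ∧ ∑ j, x j ≤ 1) ∧ inner ℝ a x = 0} := by
    rintro x ⟨h1, h2, ⟨⟨h3, -⟩, h4⟩⟩
    rw [inner_onesVector] at *
    refine ⟨⟨fun j => ?_, h2⟩, ?_⟩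
    · have := h3 j
      exact nonneg_of_mul_nonneg_right this (by positivity)
    · rw [inner_smul_right] at h4
      exact (mul_eq_zero.1 h4).resolve_left (by positivity)
  have hw := euclideanHausdorffMeasure_central_section_cone_le ha hsum
  rw [ENNReal.ofReal_one, one_mul, norm_onesVector] at hcone
  rw [hcone]
  refine (mul_le_mul_right (measure_mono hsub) _).trans ?_
  have hfac : (0 : ℝ) < ((m + 1) ! : ℕ) := by positivity
  rw [← ENNReal.ofReal_natCast, mul_comm, ← ENNReal.le_div_iff_mul_le (by simp)
    (by simp), ← ENNReal.ofReal_div_of_pos hfac] at hw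
  refine (mul_le_mul_right hw _).trans ?_
  rw [← ENNReal.ofReal_mul (by positivity)]
  refine ENNReal.ofReal_le_ofReal (le_of_eq ?_)
  rw [Nat.factorial_succ]
  push_cast
  field_simp

end SimplexSection

/-! ### Comparison of the perimeter with the volume of a central section. -/

section Perimeter

theorem finrank_inf_orthogonal {E : Type*} [NormedAddCommGroup E] [InnerProductSpace ℝ E]
    [FiniteDimensional ℝ E] {d : ℕ} (hd : finrank ℝ E = d + 2) {a b : E} (ha : a ≠ 0) (hb : b ≠ 0)
    (hab : inner ℝ a b = 0) : finrank ℝ ((ℝ ∙ a)ᗮ ⊓ (ℝ ∙ b)ᗮ : Submodule ℝ E) = d := by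
  have hli : LinearIndependent ℝ ![a, b] := by
    refine linearIndependent_of_ne_zero_of_inner_eq_zero (𝕜 := ℝ) ?_ ?_
    · intro i
      fin_cases i <;> simpa
    · intro i j hij
      fin_cases i <;> fin_cases j <;> simp_all [real_inner_comm]
  have h1 := finrank_span_eq_card hli
  have h2 : Submodule.span ℝ (range ![a, b]) = (ℝ ∙ a) ⊔ (ℝ ∙ b) := by
    rw [Matrix.range_cons, Matrix.range_cons, Matrix.range_empty, union_empty,
      Submodule.span_union]
  rw [h2, Fintype.card_fin] at h1
  have h3 := Submodule.finrank_add_finrank_orthogonal ((ℝ ∙ a) ⊔ (ℝ ∙ b))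
  rw [Submodule.inf_orthogonal]
  omega

/-- The part of the central section of the simplex in the facet opposite to the vertex `k`. -/
def centralFacet {m : ℕ} (a : EuclideanSpace ℝ (Fin m)) (k : Fin m) :
    Set (EuclideanSpace ℝ (Fin m)) :=
  centralSection a ∩ {x | x k = 0}

theorem measurableSet_centralFacet {m : ℕ} (a : EuclideanSpace ℝ (Fin m)) (k : Fin m) :
    MeasurableSet (centralFacet a k) :=
  (measurableSet_centralSection a).inter (measurableSet_eq_fun (by fun_prop) measurable_const)

/-- The boundary of the central section of a simplex is controlled by its volume. -/
theorem euclideanHausdorffMeasure_iUnion_centralFacet_le {p : ℕ}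
    {a : EuclideanSpace ℝ (Fin (p + 3))} (ha : ‖a‖ = 1) (hsum : ∑ j, a j = 0) :
    ENNReal.ofReal (1 / (p + 3)) * μHE[p] (⋃ k, centralFacet a k) ≤
      ENNReal.ofReal ((p + 1) * Real.sqrt ((p + 2) / (p + 3))) * μHE[p + 1] (centralSection a) := by
  set o := onesVector (p + 3) with ho
  set h : ℝ := 1 / (p + 3) with hh
  have hh0 : 0 < h := by positivity
  set c : EuclideanSpace ℝ (Fin (p + 3)) := h • o with hc
  have hcj : ∀ j, c j = h := fun j => by simp [hc, ho, onesVector]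
  have hao : inner ℝ a o = 0 := by rw [real_inner_comm, inner_onesVector, hsum]
  have hoo : inner ℝ o o = (p : ℝ) + 3 := by
    rw [inner_onesVector]
    simp [ho, onesVector]
  have hho : h * ((p : ℝ) + 3) = 1 := by rw [hh]; field_simp
  have ha0 : a ≠ 0 := by
    rintro rfl
    simp at ha
  have haa : inner ℝ a a = 1 := by rw [real_inner_self_eq_norm_sq, ha, one_pow]
  have ho0 : o ≠ 0 := by
    intro h0
    rw [h0, inner_zero_left] at hoo
    linarith [(Nat.cast_nonneg p : (0 : ℝ) ≤ p)]
  set V : Submodule ℝ (EuclideanSpace ℝ (Fin (p + 3))) := (ℝ ∙ a)ᗮ ⊓ (ℝ ∙ o)ᗮ with hV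
  have hVfin : finrank ℝ V = p + 1 := finrank_inf_orthogonal finrank_euclideanSpace_fin ha0 ho0 hao
  have hVmem : ∀ y, y ∈ V ↔ inner ℝ a y = 0 ∧ inner ℝ o y = 0 := fun y => by
    rw [hV, Submodule.mem_inf, Submodule.mem_orthogonal_singleton_iff_inner_right,
      Submodule.mem_orthogonal_singleton_iff_inner_right]
  have hec : ∀ k, inner ℝ c (EuclideanSpace.single k (1 : ℝ)) = h := fun k => by
    rw [EuclideanSpace.inner_single_right]
    simp [hcj]
  have hae : ∀ k, inner ℝ a (EuclideanSpace.single k (1 : ℝ)) = a k := fun k => by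
    rw [EuclideanSpace.inner_single_right]
    simp
  have hoe : ∀ k, inner ℝ o (EuclideanSpace.single k (1 : ℝ)) = 1 := fun k => by
    rw [EuclideanSpace.inner_single_right]
    simp [ho, onesVector]
  -- `w k` is minus the orthogonal projection of `e_k` to `V`, so it represents `y ↦ -y k` there.
  -- With the centroid `c` moved to the origin, facet `k` lies at distance `h / ‖w k‖`, where `‖w
  -- k‖² = 1 - h - a_k²`.
  set w : Fin (p + 3) → EuclideanSpace ℝ (Fin (p + 3)) := fun k =>
    a k • a - (EuclideanSpace.single k (1 : ℝ) - c) with hw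
  have hwV : ∀ k, w k ∈ V := by
    intro k
    rw [hVmem]
    simp only [hw, hc, inner_sub_right, inner_smul_right, hae, hoe, haa, hao, hoo,
      real_inner_comm a o]
    constructor
    · ring
    · linarith
  have hwy : ∀ k, ∀ y ∈ V, inner ℝ (w k) y = - y k := by
    intro k y hy
    rw [hVmem] at hy
    simp only [hw, hc, inner_sub_left, real_inner_smul_left, hy.1, hy.2,
      EuclideanSpace.inner_single_left]
    simp
  have hwn : ∀ k, ‖w k‖ ≤ Real.sqrt ((p + 2) / (p + 3)) := by
    intro k
    refine Real.le_sqrt_of_sq_le ?_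
    rw [← real_inner_self_eq_norm_sq, hwy k _ (hwV k)]
    have : w k k = a k * a k - (1 - h) := by simp [hw, hcj]
    rw [this]
    have h1 : 1 - h = (p + 2) / (p + 3) := by rw [hh]; field_simp; ring
    rw [← h1]
    linarith [mul_self_nonneg (a k)]
  -- Facets may overlap or even coincide (for `a^{[2]}`, those of the first two indices do), so each
  -- boundary point is assigned to a single index.
  set B : Fin (p + 3) → Set (EuclideanSpace ℝ (Fin (p + 3))) := disjointed (centralFacet a) with hB
  have hBm : ∀ k, MeasurableSet (B k) := fun k =>
    disjointedRec (fun _ _ ht => ht.diff (measurableSet_centralFacet a _))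
      (measurableSet_centralFacet a k)
  have hBF : ∀ k, B k ⊆ centralFacet a k := fun k => disjointed_subset _ _
  have hBd : Pairwise (Function.onFun Disjoint B) := disjoint_disjointed _
  set B' : Fin (p + 3) → Set (EuclideanSpace ℝ (Fin (p + 3))) := fun k =>
    (fun y => y + c) ⁻¹' B k with hB'
  have hB'm : ∀ k, MeasurableSet (B' k) := fun k => (hBm k).preimage (by fun_prop)
  have hSV : ∀ y, y + c ∈ centralSection a → y ∈ V := by
    rintro y ⟨⟨-, h1⟩, h2⟩
    rw [hVmem]
    rw [inner_add_right, hc, inner_smul_right, hao] at h2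
    rw [← inner_onesVector, ← ho, inner_add_right, hc, inner_smul_right, hoo] at h1
    constructor <;> linarith
  have hB'V : ∀ k, B' k ⊆ V := fun k y hy => hSV y (hBF k hy).1
  have hB'w : ∀ k, ∀ y ∈ B' k, inner ℝ (w k) y = h := by
    intro k y hy
    rw [hwy k y (hB'V k hy)]
    have : (y + c) k = 0 := (hBF k hy).2
    rw [PiLp.add_apply, hcj] at this
    linarith
  have hcone := fun k => euclideanHausdorffMeasure_coneOver hVfin (hwV k) hh0 (hB'm k) (hB'V k)
    (hB'w k)
  have hcV : ∀ k, coneOver (w k) h (B' k) ⊆ V := by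
    rintro k y ⟨h1, h2, h3⟩
    have := V.smul_mem (h / inner ℝ (w k) y)⁻¹ (hB'V k h3)
    rwa [inv_smul_smul₀ (by positivity)] at this
  -- On the cone over facet `k` the `k`-th coordinate is the smallest, since after scaling to the
  -- facet it equals `-h` while all others are at least `-h`.
  have hlow : ∀ k, ∀ y ∈ coneOver (w k) h (B' k), ∀ j, - inner ℝ (w k) y ≤ y j := by
    rintro k y ⟨h1, h2, h3⟩ j
    have := (hBF k h3).1.1.1 j
    rw [PiLp.add_apply, PiLp.smul_apply, hcj, smul_eq_mul] at this
    have h4 : 0 ≤ h * (y j + inner ℝ (w k) y) := by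
      have h5 : h * (y j + inner ℝ (w k) y) =
        inner ℝ (w k) y * (h / inner ℝ (w k) y * y j + h) := by field_simp
      rw [h5]
      positivity
    have := nonneg_of_mul_nonneg_right h4 hh0
    linarith
  -- A common point of two cones has equal `k`-th and `l`-th coordinates, so the same dilation sends
  -- it into both `B' k` and `B' l`, which are disjoint.
  have hdisj : Pairwise (Function.onFun Disjoint fun k => coneOver (w k) h (B' k)) := by
    intro k l hkl
    rw [Function.onFun, disjoint_left]
    intro y hk hl
    have e1 := hwy k y (hcV k hk)
    have e2 := hwy l y (hcV l hl)
    have h1 := hlow k y hk l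
    have h2 := hlow l y hl k
    have e3 : inner ℝ (w k) y = inner ℝ (w l) y := by linarith
    have hk' := hk.2.2
    have hl' := hl.2.2
    rw [e3] at hk'
    exact disjoint_left.1 (hBd hkl) hk' hl'
  have hsub : (⋃ k, coneOver (w k) h (B' k)) ⊆ (fun y => y + c) ⁻¹' centralSection a := by
    refine iUnion_subset fun k y hy => ?_
    have hyV := (hVmem y).1 (hcV k hy)
    refine ⟨⟨fun j => ?_, ?_⟩, ?_⟩
    · have := hlow k y hy j
      rw [PiLp.add_apply, hcj]
      linarith [hy.2.1]
    · rw [← inner_onesVector, inner_add_right, ← ho, hyV.2, hc, inner_smul_right, hoo]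
      linarith
    · rw [inner_add_right, hyV.1, hc, inner_smul_right, hao]
      simp
  have htrans : ∀ (d : ℕ) (S : Set (EuclideanSpace ℝ (Fin (p + 3)))),
      μHE[d] ((fun y => y + c) ⁻¹' S) = μHE[d] S := fun d S => measure_preimage_add_right _ _ _
  have hconem := fun k => measurableSet_coneOver (w k) h (hB'm k)
  calc ENNReal.ofReal h * μHE[p] (⋃ k, centralFacet a k)
      = ∑ k, ENNReal.ofReal h * μHE[p] (B' k) := by
        rw [← iUnion_disjointed, measure_iUnion hBd hBm, tsum_fintype, Finset.mul_sum]
        exact Finset.sum_congr rfl fun k _ => by rw [hB', htrans]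
    _ = ∑ k, ENNReal.ofReal ((p + 1) * ‖w k‖) * μHE[p + 1] (coneOver (w k) h (B' k)) :=
        Finset.sum_congr rfl fun k _ => hcone k
    _ ≤ ∑ k, ENNReal.ofReal ((p + 1) * Real.sqrt ((p + 2) / (p + 3))) *
          μHE[p + 1] (coneOver (w k) h (B' k)) := by
        gcongr with k
        exact hwn k
    _ = ENNReal.ofReal ((p + 1) * Real.sqrt ((p + 2) / (p + 3))) *
          μHE[p + 1] (⋃ k, coneOver (w k) h (B' k)) := by
        rw [measure_iUnion hdisj hconem, tsum_fintype, Finset.mul_sum]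
    _ ≤ _ := by
        rw [← htrans (p + 1) (centralSection a)]
        gcongr

theorem euclideanHausdorffMeasure_iUnion_centralFacet_le_const {p : ℕ}
    {a : EuclideanSpace ℝ (Fin (p + 3))} (ha : ‖a‖ = 1) (hsum : ∑ j, a j = 0) :
    μHE[p] (⋃ k, centralFacet a k) ≤
      ENNReal.ofReal (Real.sqrt (p + 2) * (p + 3) / (Real.sqrt 2 * (p ! : ℕ))) := by
  have h1 := euclideanHausdorffMeasure_iUnion_centralFacet_le ha hsum
  have h2 := euclideanHausdorffMeasure_centralSection_le (m := p + 1) ha hsum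
  have h3 := h1.trans (mul_le_mul_right h2 _)
  rw [← ENNReal.ofReal_mul (by positivity), mul_comm,
    ← ENNReal.le_div_iff_mul_le (.inl (by
      rw [ne_eq, ENNReal.ofReal_eq_zero, not_le]
      positivity)) (by simp),
    ← ENNReal.ofReal_div_of_pos (by positivity)] at h3
  refine h3.trans (ENNReal.ofReal_le_ofReal (le_of_eq ?_))
  rw [Nat.factorial_succ, Real.sqrt_div (by positivity)]
  push_cast
  rw [show (p : ℝ) + 1 + 2 = p + 3 by ring]
  field_simp

end Perimeter

/-! ### The relative boundary of the simplex as the union of its coordinate facets. -/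

section IntrinsicFrontier

theorem isClosed_regularSimplex (n : ℕ) : IsClosed (regularSimplex n) := by
  have : regularSimplex n = (⋂ j, {x | 0 ≤ x j}) ∩ {x | ∑ j, x j = 1} := by
    ext; simp [regularSimplex]
  rw [this]
  exact (isClosed_iInter fun j => isClosed_le continuous_const (by fun_prop)).inter
    (isClosed_eq (by fun_prop) continuous_const)

theorem sum_eq_one_of_mem_affineSpan {n : ℕ} {x : EuclideanSpace ℝ (Fin (n + 1))}
    (hx : x ∈ affineSpan ℝ (regularSimplex n)) : ∑ j, x j = 1 := by
  refine affineSpan_induction (p := fun x : EuclideanSpace ℝ (Fin (n + 1)) => ∑ j, x j = 1) hx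
    (fun x hx => hx.2) fun c u v w hu hv hw => ?_
  simp [Finset.sum_add_distrib, ← Finset.mul_sum, hu, hv, hw]

theorem single_mem_regularSimplex {n : ℕ} (k : Fin (n + 1)) :
    EuclideanSpace.single k (1 : ℝ) ∈ regularSimplex n := by
  refine ⟨fun j => ?_, by simp⟩
  rw [PiLp.single_apply]
  split_ifs <;> norm_num

theorem mem_intrinsicFrontier_regularSimplex {n : ℕ} {x : EuclideanSpace ℝ (Fin (n + 1))} :
    x ∈ intrinsicFrontier ℝ (regularSimplex n) ↔ x ∈ regularSimplex n ∧ ∃ k, x k = 0 := by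
  constructor
  · intro hx
    have hxΔ := intrinsicFrontier_subset (isClosed_regularSimplex n) hx
    refine ⟨hxΔ, ?_⟩
    by_contra! hpos
    obtain ⟨y, hy, rfl⟩ := mem_intrinsicFrontier.1 hx
    refine hy.2 (mem_interior.2 ⟨(Subtype.val ⁻¹' ⋂ j, {x | 0 < x j}), ?_, ?_, ?_⟩)
    · intro z hz
      simp only [mem_preimage, mem_iInter, mem_ofPred_eq] at hz
      exact ⟨fun j => (hz j).le, sum_eq_one_of_mem_affineSpan z.2⟩
    · refine IsOpen.preimage continuous_subtype_val (isOpen_iInter_of_finite fun j => ?_)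
      exact isOpen_lt continuous_const (by fun_prop)
    · simp only [mem_preimage, mem_iInter, mem_ofPred_eq]
      exact fun j => (hxΔ.1 j).lt_of_ne (hpos j).symm
  · rintro ⟨hx, k, hk⟩
    have hxs := subset_affineSpan ℝ _ hx
    rw [mem_intrinsicFrontier]
    refine ⟨⟨x, hxs⟩, ⟨subset_closure hx, fun hint => ?_⟩, rfl⟩
    have hes := subset_affineSpan ℝ _ (single_mem_regularSimplex k)
    -- On the line from `x` to the vertex `e_k` the `k`-th coordinate is `t`, so arbitrarily small
    -- negative `t` leave the simplex within its affine span.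
    set L : ℝ → affineSpan ℝ (regularSimplex n) := fun t =>
      ⟨AffineMap.lineMap x (EuclideanSpace.single k (1 : ℝ)) t,
        AffineMap.lineMap_mem t hxs hes⟩ with hL
    have hLc : Continuous L := by
      refine Continuous.subtype_mk ?_ _
      exact AffineMap.lineMap_continuous
    have h0 : L 0 = ⟨x, hxs⟩ := by simp [hL]
    have hnhds : L ⁻¹' (Subtype.val ⁻¹' regularSimplex n) ∈ nhds (0 : ℝ) :=
      hLc.continuousAt.preimage_mem_nhds (by rw [h0]; exact mem_interior_iff_mem_nhds.1 hint)
    obtain ⟨ε, hε, hball⟩ := Metric.mem_nhds_iff.1 hnhds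
    have hmem : -(ε / 2) ∈ Metric.ball (0 : ℝ) ε := by
      rw [Metric.mem_ball, dist_zero_right, norm_neg, Real.norm_of_nonneg (by positivity)]
      linarith
    have := (hball hmem).1 k
    simp only [hL, AffineMap.lineMap_apply] at this
    simp [hk] at this
    linarith

theorem sectionHyperplane_inter_intrinsicFrontier {n : ℕ} (a : EuclideanSpace ℝ (Fin (n + 1))) :
    sectionHyperplane a 0 ∩ intrinsicFrontier ℝ (regularSimplex n) = ⋃ k, centralFacet a k := by
  ext x
  rw [mem_inter_iff, mem_intrinsicFrontier_regularSimplex, mem_iUnion]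
  constructor
  · rintro ⟨h1, h2, k, h3⟩
    exact ⟨k, ⟨h2, h1⟩, h3⟩
  · rintro ⟨k, ⟨h2, h1⟩, h3⟩
    exact ⟨h1, h2, k, h3⟩

end IntrinsicFrontier

/-! ### Volumes of weighted simplices and of their slanted facets. -/

section WeightedSimplex

theorem expMeasure_Ioi_zero : expMeasure 1 (Ioi 0) = 1 := by
  rw [← lintegral_indicator_one measurableSet_Ioi,
    IsFourPoint.lintegral_expMeasure (measurable_one.indicator measurableSet_Ioi),
    setLIntegral_congr Ioi_ae_eq_Ici.symm, setLIntegral_congr_fun measurableSet_Ioi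
      (g := fun x => ENNReal.ofReal (Real.exp (-x))) fun x hx => by simp [indicator_of_mem hx],
    setLIntegral_congr Ioi_ae_eq_Ici, setLIntegral_Ici_exp_neg]
  simp

variable {ι : Type*} [Fintype ι]

open scoped Pointwise in
/-- The volume of the solid standard simplex. -/
theorem factorial_mul_volume_solidSimplex :
    ((Fintype.card ι)! : ℕ) * volume {x : ι → ℝ | (∀ j, 0 < x j) ∧ ∑ j, x j ≤ 1} = 1 := by
  have hprob : IsProbabilityMeasure (expMeasure 1) := isProbabilityMeasure_expMeasure one_pos
  set D := {x : ι → ℝ | (∀ j, 0 < x j) ∧ ∑ j, x j ≤ 1} with hD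
  have hm : MeasurableSet (univ.pi fun _ : ι => Ioi (0 : ℝ)) :=
    MeasurableSet.univ_pi fun _ => measurableSet_Ioi
  -- The open orthant has probability 1, and its layer at level `s` is `s • D`, so the layer-cake
  -- formula evaluates to `n!` times the volume of `D`, with `n` the cardinality of `ι`.
  have h := pi_expMeasure_apply hm
  rw [Measure.pi_pi] at h
  simp only [expMeasure_Ioi_zero, Finset.prod_const_one] at h
  rw [h, ← setLIntegral_Ici_exp_neg_mul_pow, setLIntegral_congr Ioi_ae_eq_Ici.symm,
    setLIntegral_congr Ioi_ae_eq_Ici.symm, ← lintegral_mul_const _ (by fun_prop)]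
  refine setLIntegral_congr_fun measurableSet_Ioi fun s (hs : 0 < s) => ?_
  have hset : (univ.pi fun _ : ι => Ioi (0 : ℝ)) ∩ {x | (∀ j, 0 ≤ x j) ∧ ∑ j, x j ≤ s} =
      s • D := by
    ext x
    rw [mem_smul_set_iff_inv_smul_mem₀ hs.ne']
    simp only [mem_inter_iff, mem_univ_pi, mem_Ioi, hD, mem_ofPred_eq, Pi.smul_apply, smul_eq_mul,
      ← Finset.mul_sum]
    have h1 : ∀ t, 0 < s⁻¹ * t ↔ 0 < t := fun t => by
      rw [mul_pos_iff_of_pos_left (by positivity)]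
    have h2 : ∀ t, s⁻¹ * t ≤ 1 ↔ t ≤ s := fun t => by
      rw [inv_mul_le_iff₀ hs, mul_one]
    simp only [h1, h2]
    exact ⟨fun h => ⟨h.1, h.2.2⟩, fun h => ⟨h.1, fun j => (h.1 j).le, h.2⟩⟩
  simp only [hset, Measure.addHaar_smul_of_nonneg _ hs.le, finrank_fintype_fun_eq_card]
  ring

theorem volume_weighted_solidSimplex {c : ι → ℝ} (hc : ∀ j, 0 < c j) :
    volume {x : ι → ℝ | (∀ j, 0 < x j) ∧ ∑ j, c j * x j ≤ 1} =
      ENNReal.ofReal (1 / (((Fintype.card ι)! : ℕ) * ∏ j, c j)) := by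
  classical
  have hdet : LinearMap.det (Matrix.toLin' (Matrix.diagonal c)) = ∏ j, c j := by
    rw [LinearMap.det_toLin', Matrix.det_diagonal]
  have hpos : 0 < ∏ j, c j := Finset.prod_pos fun j _ => hc j
  have hpre : {x : ι → ℝ | (∀ j, 0 < x j) ∧ ∑ j, c j * x j ≤ 1} =
      Matrix.toLin' (Matrix.diagonal c) ⁻¹' {x : ι → ℝ | (∀ j, 0 < x j) ∧ ∑ j, x j ≤ 1} := by
    ext x
    simp [Matrix.mulVec_diagonal, mul_pos_iff_of_pos_left (hc _)]
  rw [hpre, Measure.addHaar_preimage_linearMap _ (by rw [hdet]; exact hpos.ne'), hdet,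
    abs_of_pos (by positivity)]
  have h := factorial_mul_volume_solidSimplex (ι := ι)
  have hfac : (0 : ℝ) < ((Fintype.card ι)! : ℕ) := by positivity
  rw [mul_comm] at h
  replace h := ENNReal.eq_inv_of_mul_eq_one_left h
  rw [← ENNReal.ofReal_natCast, ← ENNReal.ofReal_inv_of_pos hfac] at h
  rw [h, ← ENNReal.ofReal_mul (by positivity)]
  congr 1
  field_simp

/-- The area of the slanted facet of a weighted simplex. -/
theorem euclideanHausdorffMeasure_weighted_facet {d : ℕ} {c : EuclideanSpace ℝ (Fin (d + 1))}
    (hc : ∀ j, 0 < c j) :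
    μHE[d] {x : EuclideanSpace ℝ (Fin (d + 1)) | (∀ j, 0 < x j) ∧ ∑ j, c j * x j = 1} =
      ENNReal.ofReal (‖c‖ / ((d ! : ℕ) * ∏ j, c j)) := by
  have hlin : Measurable fun x : EuclideanSpace ℝ (Fin (d + 1)) => ∑ j, c j * x j := by fun_prop
  have hposm : MeasurableSet {x : EuclideanSpace ℝ (Fin (d + 1)) | ∀ j, 0 < x j} := by
    have : {x : EuclideanSpace ℝ (Fin (d + 1)) | ∀ j, 0 < x j} = ⋂ j, {x | 0 < x j} := by
      ext; simp
    rw [this]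
    exact MeasurableSet.iInter fun j => measurableSet_lt measurable_const (by fun_prop)
  have hpos : 0 < ∏ j, c j := Finset.prod_pos fun j _ => hc j
  have hcone := euclideanHausdorffMeasure_coneOver (W := ⊤) (d := d)
    (B := {x : EuclideanSpace ℝ (Fin (d + 1)) | (∀ j, 0 < x j) ∧ ∑ j, c j * x j = 1})
    (by rw [finrank_top]; exact finrank_euclideanSpace_fin) (w := c) Submodule.mem_top one_pos
    (hposm.inter (measurableSet_eq_fun hlin measurable_const)) (fun _ _ => Submodule.mem_top)
    (fun x hx => by rw [inner_eq_sum_mul]; exact hx.2)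
  have hset : coneOver c 1 {x : EuclideanSpace ℝ (Fin (d + 1)) |
      (∀ j, 0 < x j) ∧ ∑ j, c j * x j = 1} = WithLp.ofLp ⁻¹'
        {x : Fin (d + 1) → ℝ | (∀ j, 0 < x j) ∧ ∑ j, c j * x j ≤ 1} := by
    ext x
    constructor
    · rintro ⟨h1, h2, h3, -⟩
      refine ⟨fun j => ?_, ?_⟩
      · have h4 := h3 j
        exact pos_of_mul_pos_right h4 (by positivity)
      · rwa [inner_eq_sum_mul] at h2
    · rintro ⟨h1, h2⟩
      have h3 : 0 < inner ℝ c x := by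
        rw [inner_eq_sum_mul]
        exact Finset.sum_pos (fun j _ => mul_pos (hc j) (h1 j)) Finset.univ_nonempty
      refine ⟨h3, by rwa [inner_eq_sum_mul], fun j => mul_pos (by positivity) (h1 j), ?_⟩
      rw [← inner_eq_sum_mul, inner_smul_right]
      field_simp
  have hposm' : MeasurableSet {x : Fin (d + 1) → ℝ | ∀ j, 0 < x j} := by
    have : {x : Fin (d + 1) → ℝ | ∀ j, 0 < x j} = ⋂ j, {x | 0 < x j} := by
      ext; simp
    rw [this]
    exact MeasurableSet.iInter fun j => measurableSet_lt measurable_const (by fun_prop)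
  have hlin' : Measurable fun x : Fin (d + 1) → ℝ => ∑ j, c j * x j := by fun_prop
  have hm := hposm'.inter (measurableSet_le hlin' (measurable_const (a := (1 : ℝ))))
  rw [ENNReal.ofReal_one, one_mul, hset, EuclideanSpace.euclideanHausdorffMeasure_eq_volume] at hcone
  rw [hcone]
  have hvol := (PiLp.volume_preserving_ofLp (Fin (d + 1))).measure_preimage hm.nullMeasurableSet
  have hv := volume_weighted_solidSimplex (c := fun j => c j) hc
  rw [Fintype.card_fin] at hv
  refine (congrArg _ (hvol.trans hv)).trans ?_
  rw [← ENNReal.ofReal_mul (by positivity)]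
  congr 1
  rw [Nat.factorial_succ]
  push_cast
  field_simp

end WeightedSimplex

/-! ### Lower bound for the perimeter in the edge direction. -/

section EdgeDirection

theorem inner_edgeDirection {p : ℕ} (x : EuclideanSpace ℝ (Fin (p + 3))) :
    inner ℝ (edgeDirection (p + 2)) x = (x 0 - x 1) / Real.sqrt 2 := by
  have h1 : inner ℝ (edgeDirection (p + 2)) x = ∑ j : Fin (p + 3), edgeDirection (p + 2) j * x j :=
    inner_eq_sum_mul _ _
  rw [h1, Fin.sum_univ_succ, Fin.sum_univ_succ]
  simp [edgeDirection]
  ring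

/-- The isometric embedding onto the subspace where the first two coordinates vanish. -/
def faceEmbedding (p : ℕ) (y : EuclideanSpace ℝ (Fin (p + 1))) : EuclideanSpace ℝ (Fin (p + 3)) :=
  WithLp.toLp 2 (Fin.cons 0 (Fin.cons 0 y.ofLp))

theorem isometry_faceEmbedding (p : ℕ) : Isometry (faceEmbedding p) := by
  refine Isometry.of_dist_eq fun x y => ?_
  simp [EuclideanSpace.dist_eq, faceEmbedding, Fin.sum_univ_succ (n := p + 2),
    Fin.sum_univ_succ (n := p + 1)]

/-- The isometric embedding onto the subspace where the first two coordinates agree and the one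
with index `i + 2` vanishes. -/
noncomputable def bisectorEmbedding {p : ℕ} (i : Fin (p + 1)) (y : EuclideanSpace ℝ (Fin (p + 1))) :
    EuclideanSpace ℝ (Fin (p + 3)) :=
  WithLp.toLp 2 (Fin.cons (y 0 / Real.sqrt 2) (Fin.cons (y 0 / Real.sqrt 2)
    (Fin.insertNth (α := fun _ => ℝ) i 0 fun j => y j.succ)))

theorem isometry_bisectorEmbedding {p : ℕ} (i : Fin (p + 1)) :
    Isometry (bisectorEmbedding i) := by
  refine Isometry.of_dist_eq fun x y => ?_
  rw [EuclideanSpace.dist_eq, EuclideanSpace.dist_eq]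
  congr 1
  rw [Fin.sum_univ_succ, Fin.sum_univ_succ, Fin.sum_univ_succAbove _ i, Fin.sum_univ_succ]
  simp only [bisectorEmbedding, Fin.cons_zero, Fin.cons_succ, Fin.insertNth_apply_same,
    Fin.insertNth_apply_succAbove, Real.dist_eq, sq_abs, ← sub_div, div_pow]
  rw [Real.sq_sqrt (by norm_num)]
  ring

/-- The section lies in `x 0 = x 1`, so its part with `x 0 = 0` contains a copy of the regular
`p`-simplex; the left side is the area of that simplex. -/
theorem ofReal_face_le {p : ℕ} :
    ENNReal.ofReal (Real.sqrt (p + 1) / (p ! : ℕ)) ≤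
      μHE[p] ((⋃ k, centralFacet (edgeDirection (p + 2)) k) ∩ {x | x 0 = 0}) := by
  have h := euclideanHausdorffMeasure_weighted_facet (c := onesVector (p + 1))
    fun j => by simp [onesVector]
  rw [norm_onesVector, ← (isometry_faceEmbedding p).euclideanHausdorffMeasure_image] at h
  have e : Real.sqrt (p + 1) / (p ! : ℕ) =
      Real.sqrt ((p + 1 : ℕ) : ℝ) / ((p ! : ℕ) * ∏ j, onesVector (p + 1) j) := by
    simp [onesVector]
  rw [e, ← h]
  refine measure_mono ?_
  rintro _ ⟨y, ⟨h1, h2⟩, rfl⟩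
  refine ⟨mem_iUnion.2 ⟨0, ⟨⟨?_, ?_⟩, ?_⟩, ?_⟩, ?_⟩
  · intro j
    refine Fin.cases ?_ (fun j => Fin.cases ?_ (fun j => ?_) j) j
    · simp [faceEmbedding]
    · simp [faceEmbedding]
    · simpa [faceEmbedding] using (h1 j).le
  · rw [Fin.sum_univ_succ, Fin.sum_univ_succ]
    simpa [faceEmbedding, onesVector] using h2
  · rw [inner_edgeDirection, show (1 : Fin (p + 3)) = Fin.succ 0 from rfl]
    simp only [faceEmbedding, Fin.cons_zero, Fin.cons_succ, sub_self, zero_div]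
  · simp [faceEmbedding]
  · simp [faceEmbedding]

theorem ofReal_bisector_le {p : ℕ} (i : Fin (p + 1)) :
    ENNReal.ofReal (Real.sqrt (p + 2) / (Real.sqrt 2 * (p ! : ℕ))) ≤
      μHE[p] ((⋃ k, centralFacet (edgeDirection (p + 2)) k) ∩
        {x | 0 < x 0 ∧ x i.succ.succ = 0 ∧ ∀ j, 0 < x (i.succAbove j).succ.succ}) := by
  -- With `y 0 = √2 x 0` as isometric coordinate on the diagonal `x 0 = x 1`, the two equal
  -- coordinates contribute `2 x 0 = √2 y 0` to the sum.
  set c : EuclideanSpace ℝ (Fin (p + 1)) := WithLp.toLp 2 (Fin.cons (Real.sqrt 2) fun _ => 1) with hc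
  have h := euclideanHausdorffMeasure_weighted_facet (c := c) fun j => by
    refine Fin.cases ?_ (fun j => ?_) j <;> simp [hc]
  rw [← (isometry_bisectorEmbedding i).euclideanHausdorffMeasure_image] at h
  have hcn : ‖c‖ = Real.sqrt (p + 2) := by
    rw [EuclideanSpace.norm_eq, Fin.sum_univ_succ]
    simp [hc, add_comm]
  have hcp : ∏ j, c j = Real.sqrt 2 := by
    rw [Fin.prod_univ_succ]
    simp [hc]
  rw [hcn, hcp, mul_comm] at h
  rw [← h]
  refine measure_mono ?_
  rintro _ ⟨y, ⟨h1, h2⟩, rfl⟩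
  have h0 : 0 < y 0 / Real.sqrt 2 := div_pos (h1 0) (by positivity)
  rw [Fin.sum_univ_succ] at h2
  refine ⟨mem_iUnion.2 ⟨i.succ.succ, ⟨⟨?_, ?_⟩, ?_⟩, ?_⟩, ?_, ?_, ?_⟩
  · intro j
    refine Fin.cases ?_ (fun j => Fin.cases ?_ (fun j => ?_) j) j
    · simpa [bisectorEmbedding] using h0.le
    · simpa [bisectorEmbedding] using h0.le
    · refine Fin.succAboveCases i ?_ (fun j => ?_) j
      · simp [bisectorEmbedding]
      · simpa [bisectorEmbedding] using (h1 j.succ).le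
  · rw [Fin.sum_univ_succ, Fin.sum_univ_succ, Fin.sum_univ_succAbove _ i]
    simp only [hc, Fin.cons_zero, Fin.cons_succ, one_mul] at h2
    simp only [bisectorEmbedding, Fin.cons_zero, Fin.cons_succ, Fin.insertNth_apply_same,
      Fin.insertNth_apply_succAbove, zero_add]
    rw [← h2, ← add_assoc]
    congr 1
    field_simp
    rw [Real.sq_sqrt (by norm_num)]
    ring
  · rw [inner_edgeDirection, show (1 : Fin (p + 3)) = Fin.succ 0 from rfl]
    simp only [bisectorEmbedding, Fin.cons_zero, Fin.cons_succ, sub_self, zero_div]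
  · simp [bisectorEmbedding]
  · simpa [bisectorEmbedding] using h0
  · simp [bisectorEmbedding]
  · intro j
    simpa [bisectorEmbedding] using h1 j.succ

theorem ofReal_le_euclideanHausdorffMeasure_edgeDirection (p : ℕ) :
    ENNReal.ofReal (Real.sqrt (p + 1) / (p ! : ℕ) +
        (p + 1) * (Real.sqrt (p + 2) / (Real.sqrt 2 * (p ! : ℕ)))) ≤
      μHE[p] (⋃ k, centralFacet (edgeDirection (p + 2)) k) := by
  set S := ⋃ k, centralFacet (edgeDirection (p + 2)) k with hS
  have hSm : MeasurableSet S := MeasurableSet.iUnion fun k => measurableSet_centralFacet _ k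
  -- Strict positivity of the remaining coordinates makes the pieces disjoint, so their areas add
  -- up.
  set D : Fin (p + 1) → Set (EuclideanSpace ℝ (Fin (p + 3))) := fun i =>
    {x | 0 < x 0 ∧ x i.succ.succ = 0 ∧ ∀ j, 0 < x (i.succAbove j).succ.succ} with hD
  have hDm : ∀ i, MeasurableSet (D i) := fun i => by
    have h3 : MeasurableSet {x : EuclideanSpace ℝ (Fin (p + 3)) |
        ∀ j, 0 < x (i.succAbove j).succ.succ} := by
      have : {x : EuclideanSpace ℝ (Fin (p + 3)) | ∀ j, 0 < x (i.succAbove j).succ.succ} =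
          ⋂ j, {x | 0 < x (i.succAbove j).succ.succ} := by
        ext; simp
      rw [this]
      exact MeasurableSet.iInter fun j => measurableSet_lt measurable_const (by fun_prop)
    have h1 : MeasurableSet {x : EuclideanSpace ℝ (Fin (p + 3)) | 0 < x 0} :=
      measurableSet_lt measurable_const (by fun_prop)
    have h2 : MeasurableSet {x : EuclideanSpace ℝ (Fin (p + 3)) | x i.succ.succ = 0} :=
      measurableSet_eq_fun (by fun_prop) measurable_const
    exact h1.inter (h2.inter h3)
  have hdisj : Pairwise (Function.onFun Disjoint fun i => S ∩ D i) := by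
    intro i j hij
    rw [Function.onFun, disjoint_left]
    rintro x ⟨-, -, -, h⟩ ⟨-, -, h', -⟩
    obtain ⟨l, hl⟩ := Fin.exists_succAbove_eq hij.symm
    have := h l
    rw [hl, h'] at this
    exact this.false
  have hdisj0 : Disjoint (S ∩ {x | x 0 = 0}) (⋃ i, S ∩ D i) := by
    rw [disjoint_left]
    rintro x ⟨-, h0⟩ hx
    obtain ⟨i, -, h, -⟩ := mem_iUnion.1 hx
    exact h.ne' h0
  have hsub : (S ∩ {x | x 0 = 0}) ∪ (⋃ i, S ∩ D i) ⊆ S :=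
    union_subset inter_subset_left (iUnion_subset fun i => inter_subset_left)
  refine le_trans ?_ (measure_mono hsub)
  rw [measure_union hdisj0 (MeasurableSet.iUnion fun i => hSm.inter (hDm i)),
    measure_iUnion hdisj fun i => hSm.inter (hDm i), tsum_fintype,
    ENNReal.ofReal_add (by positivity) (by positivity)]
  refine add_le_add ofReal_face_le ?_
  calc ENNReal.ofReal ((p + 1) * (Real.sqrt (p + 2) / (Real.sqrt 2 * (p ! : ℕ))))
      = ∑ _i : Fin (p + 1), ENNReal.ofReal (Real.sqrt (p + 2) / (Real.sqrt 2 * (p ! : ℕ))) := by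
        rw [Finset.sum_const, Finset.card_univ, Fintype.card_fin, ENNReal.ofReal_mul (by positivity),
          nsmul_eq_mul]
        congr 1
        rw [← Nat.cast_succ, ENNReal.ofReal_natCast]
    _ ≤ _ := Finset.sum_le_sum fun i _ => ofReal_bisector_le i

end EdgeDirection

/-! ### Conclusion. -/

theorem mainTheorem12 (n : ℕ) (hn : 3 ≤ n) (a : EuclideanSpace ℝ (Fin (n + 1)))
    (ha : ‖a‖ = 1) (hsum : ∑ j, a j = 0) :
    simplexPerimeter n a 0 ≤
        ENNReal.ofReal (Real.sqrt n * ((n : ℝ) + 1) / (Real.sqrt 2 * ((n - 2)! : ℕ))) ∧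
      ENNReal.ofReal (Real.sqrt n * ((n : ℝ) + 1) / (Real.sqrt 2 * ((n - 2)! : ℕ))) ≤
        ENNReal.ofReal (1 + 1 / (n : ℝ)) * simplexPerimeter n (edgeDirection n) 0 := by
  obtain ⟨p, rfl⟩ : ∃ p, n = p + 2 := ⟨n - 2, by omega⟩
  rw [simplexPerimeter, simplexPerimeter, sectionHyperplane_inter_intrinsicFrontier,
    sectionHyperplane_inter_intrinsicFrontier, Nat.add_sub_cancel]
  push_cast
  constructor
  · refine (euclideanHausdorffMeasure_iUnion_centralFacet_le_const ha hsum).trans (le_of_eq ?_)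
    congr 2
    ring
  · refine le_trans ?_ (mul_le_mul_right (ofReal_le_euclideanHausdorffMeasure_edgeDirection p) _)
    rw [← ENNReal.ofReal_mul (by positivity)]
    refine ENNReal.ofReal_le_ofReal ?_
    -- After clearing denominators the claim is `(p + 2) √(p + 2) ≤ √2 √(p + 1) + (p + 1) √(p + 2)`,
    -- which is exactly this.
    have h1 : Real.sqrt (p + 2) ≤ Real.sqrt 2 * Real.sqrt (p + 1) := by
      rw [← Real.sqrt_mul (by norm_num)]
      exact Real.sqrt_le_sqrt (by linarith [(Nat.cast_nonneg p : (0 : ℝ) ≤ p)])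
    have e : (1 + 1 / ((p : ℝ) + 2)) * (Real.sqrt (p + 1) / (p ! : ℕ) +
        (p + 1) * (Real.sqrt (p + 2) / (Real.sqrt 2 * (p ! : ℕ)))) =
        ((p : ℝ) + 3) * (Real.sqrt 2 * Real.sqrt (p + 1) + (p + 1) * Real.sqrt (p + 2)) / (p + 2) /
          (Real.sqrt 2 * (p ! : ℕ)) := by
      field_simp
      ring
    rw [e]
    gcongr
    rw [le_div_iff₀ (by positivity)]
    have h2 : (0 : ℝ) ≤ p + 3 := by positivity
    linarith [mul_le_mul_of_nonneg_left h1 h2]
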